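/- Let $R$ be a commutative Artinian ring and let $\Lambda$ and $\Gamma$ be Artin $R$-algebras, i.e. $R$-algebras that are finitely generated as $R$-modules. Modules are left modules unless stated otherwise. Let ${}_\Lambda M_\Gamma$ and ${}_\Gamma N_\Lambda$ be bimodules that induce a symmetrical separable equivalence between $\Lambda$ and $\Gamma$. This means that $M$ and $N$ are finitely generated and projective as left modules and as right modules, that there are a $\Lambda$-bimodule $X$, a $\Gamma$-bimodule $Y$ and bimodule isomorphisms $$M\otimes_\Gamma N\cong \Lambda\oplus X,\qquad N\otimes_\Lambda M\cong\Gamma\oplus Y,$$ and that both $(M\otimes_\Gamma-,\,N\otimes_\Lambda-)$ and $(N\otimes_\Lambda-,\,M\otimes_\Gamma-)$ are adjoint pairs of functors between $\mathrm{Mod}\,\Lambda$ and $\mathrm{Mod}\,\Gamma$. Suppose that $M\otimes_\Gamma N$ is centrally projective over $\Lambda$ and that $N\otimes_\Lambda M$ is centrally projective over $\Gamma$, i.e. $M\otimes_\Gamma N$ is a bimodule direct summand of $\Lambda^n$ and $N\otimes_\Lambda M$ is a bimodule direct summand of $\Gamma^m$ for some $n,m\ge 0$. Then (1) $\operatorname{rig.dim}\Lambda=\operatorname{rig.dim}\Gamma$,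 and (2) $\operatorname{rep.dim}\Lambda=\operatorname{rep.dim}\Gamma$. Here an Auslander generator for an Artin algebra $A$ is a finitely generated $A$-module $V$ such that every finitely generated $A$-module is a quotient of $V^n$ for some $n$ and a submodule of $V^n$ for some $n$. The dominant dimension $\operatorname{dom.dim}B$ of a ring $B$ is the least $n\ge 0$ such that the term $I^n$ of the minimal injective coresolution $0\to B\to I^0\to I^1\to\cdots$ of the left module ${}_BB$ is not projective, and $\infty$ if there is no such $n$. Writing $\operatorname{End}_A(V)$ for the endomorphism ring of $V$, acting on $V$ from the right, $$\operatorname{rig.dim}A=\sup_V\operatorname{dom.dim}\operatorname{End}_A(V),\qquad \operatorname{rep.dim}A=\inf_V\operatorname{gl.dim}\operatorname{End}_A(V),$$ where $V$ runs through all Auslander generators for $A$. Equality (1) holds both for this rigidity dimension and for the variant in which the supremum is taken only over those $V$ with $\operatorname{gl.dim}\operatorname{End}_A(V)<\infty$. -/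

import Mathlib

open CategoryTheory
open scoped TensorProduct MulOpposite

/-! Bimodules: a `(Λ, Γ)`-bimodule is an additive group `M` with `[Module Λ M]`,
`[Module Γᵐᵒᵖ M]` (the right action) and `[SMulCommClass Λ Γᵐᵒᵖ M]`. -/

section BalancedTensor

universe v₁ v₂ v₃ v₄ v₅ v₆ v₇

/-- The relations `m γ ⊗ n - m ⊗ γ n` cutting `M ⊗_Γ N` out of `M ⊗_ℤ N`. -/
def BalancedTensor.relations (Γ : Type v₁) [Ring Γ] (M : Type v₂) [AddCommGroup M] [Module Γᵐᵒᵖ M]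
    (N : Type v₃) [AddCommGroup N] [Module Γ N] : AddSubgroup (M ⊗[ℤ] N) :=
  AddSubgroup.closure {t | ∃ (m : M) (c : Γ) (n : N),
    t = (MulOpposite.op c • m) ⊗ₜ[ℤ] n - m ⊗ₜ[ℤ] (c • n)}

/-- The tensor product `M ⊗_Γ N` of a right `Γ`-module and a left `Γ`-module over an arbitrary
(not necessarily commutative) ring `Γ`. -/
def BalancedTensor (Γ : Type v₁) [Ring Γ] (M : Type v₂) [AddCommGroup M] [Module Γᵐᵒᵖ M]
    (N : Type v₃) [AddCommGroup N] [Module Γ N] : Type (max v₂ v₃) :=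
  (M ⊗[ℤ] N) ⧸ BalancedTensor.relations Γ M N

namespace BalancedTensor

variable (Γ : Type v₁) [Ring Γ] {M : Type v₂} [AddCommGroup M] [Module Γᵐᵒᵖ M]
  {N : Type v₃} [AddCommGroup N] [Module Γ N]
  {M' : Type v₄} [AddCommGroup M'] [Module Γᵐᵒᵖ M'] {N' : Type v₅} [AddCommGroup N'] [Module Γ N']

instance instAddCommGroup (M : Type v₂) [AddCommGroup M] [Module Γᵐᵒᵖ M]
    (N : Type v₃) [AddCommGroup N] [Module Γ N] : AddCommGroup (BalancedTensor Γ M N) :=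
  inferInstanceAs (AddCommGroup ((M ⊗[ℤ] N) ⧸ relations Γ M N))

/-- The class of the pure tensor `m ⊗ n`. -/
def tmul (m : M) (n : N) : BalancedTensor Γ M N :=
  QuotientAddGroup.mk' (relations Γ M N) (m ⊗ₜ[ℤ] n)

theorem smul_tmul (m : M) (c : Γ) (n : N) :
    tmul Γ (MulOpposite.op c • m) n = tmul Γ m (c • n) :=
  (QuotientAddGroup.eq_iff_sub_mem).2 (AddSubgroup.subset_closure ⟨m, c, n, rfl⟩)

theorem hom_ext {G : Type v₆} [AddCommGroup G] {f g : BalancedTensor Γ M N →+ G}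
    (h : ∀ m n, f (tmul Γ m n) = g (tmul Γ m n)) : f = g := by
  ext x
  obtain ⟨t, rfl⟩ := QuotientAddGroup.mk'_surjective (relations Γ M N) x
  induction t using TensorProduct.induction_on with
  | zero => exact (map_zero f).trans (map_zero g).symm
  | tmul m n => exact h m n
  | add a b ha hb =>
    exact (map_add f _ _).trans ((congrArg₂ (· + ·) ha hb).trans (map_add g _ _).symm)

/-- The map `f ⊗_Γ g`. -/
noncomputable def map (f : M →ₗ[Γᵐᵒᵖ] M') (g : N →ₗ[Γ] N') :
    BalancedTensor Γ M N →+ BalancedTensor Γ M' N' :=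
  QuotientAddGroup.map (relations Γ M N) (relations Γ M' N')
    (TensorProduct.map f.toAddMonoidHom.toIntLinearMap
      g.toAddMonoidHom.toIntLinearMap).toAddMonoidHom
    (by
      refine (AddSubgroup.closure_le _).2 ?_
      rintro _ ⟨m, c, n, rfl⟩
      refine AddSubgroup.subset_closure ⟨f m, c, g n, ?_⟩
      rw [map_sub]
      exact congrArg₂ (fun a b => a ⊗ₜ[ℤ] g n - f m ⊗ₜ[ℤ] b) (f.map_smul _ m) (g.map_smul c n))

@[simp]
theorem map_tmul (f : M →ₗ[Γᵐᵒᵖ] M') (g : N →ₗ[Γ] N') (m : M) (n : N) :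
    map Γ f g (tmul Γ m n) = tmul Γ (f m) (g n) := rfl

theorem add_tmul (m m' : M) (n : N) :
    tmul Γ (m + m') n = tmul Γ m n + tmul Γ m' n := by
  simp [tmul, TensorProduct.add_tmul]; rfl

theorem tmul_add (m : M) (n n' : N) :
    tmul Γ m (n + n') = tmul Γ m n + tmul Γ m n' := by
  simp [tmul, TensorProduct.tmul_add]; rfl

theorem zero_tmul (n : N) : tmul Γ (0 : M) n = 0 := by
  simp [tmul, TensorProduct.zero_tmul]; rfl

theorem tmul_zero (m : M) : tmul Γ m (0 : N) = 0 := by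
  simp [tmul, TensorProduct.tmul_zero]; rfl

/-- The action of `S` on `M ⊗_Γ N` through an action of `S` on `M`. -/
noncomputable def leftAction (S : Type v₆) [Ring S] [Module S M] [SMulCommClass S Γᵐᵒᵖ M] :
    S →+* AddMonoid.End (BalancedTensor Γ M N) where
  toFun s := map Γ (DistribSMul.toLinearMap Γᵐᵒᵖ M s) LinearMap.id
  map_one' := hom_ext Γ fun m n => by simp; rfl
  map_mul' s t := hom_ext Γ fun m n => by simp [mul_smul]; rfl
  map_zero' := hom_ext Γ fun m n => by simp [zero_tmul]; rfl
  map_add' s t := hom_ext Γ fun m n => by simp [add_smul, add_tmul]; rfl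

/-- The action of `S` on `M ⊗_Γ N` through an action of `S` on `N`. -/
noncomputable def rightAction (S : Type v₆) [Ring S] [Module S N] [SMulCommClass Γ S N] :
    S →+* AddMonoid.End (BalancedTensor Γ M N) where
  toFun s :=
    haveI : SMulCommClass S Γ N := SMulCommClass.symm _ _ _
    map Γ LinearMap.id (DistribSMul.toLinearMap Γ N s)
  map_one' := hom_ext Γ fun m n => by simp; rfl
  map_mul' s t := hom_ext Γ fun m n => by simp [mul_smul]; rfl
  map_zero' := hom_ext Γ fun m n => by simp [tmul_zero]; rfl
  map_add' s t := hom_ext Γ fun m n => by simp [add_smul, tmul_add]; rfl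

/-- If `M` is a `(Λ, Γ)`-bimodule, then `M ⊗_Γ N` is a left `Λ`-module. -/
noncomputable instance instModuleLeft {Λ : Type v₆} [Ring Λ] [Module Λ M]
    [SMulCommClass Λ Γᵐᵒᵖ M] : Module Λ (BalancedTensor Γ M N) :=
  Module.compHom _ (leftAction Γ (M := M) (N := N) Λ)

/-- If `N` is a `(Γ, Δ)`-bimodule, then `M ⊗_Γ N` is a right `Δ`-module. -/
noncomputable instance instModuleRight {Δ : Type v₆} [Ring Δ] [Module Δᵐᵒᵖ N]
    [SMulCommClass Γ Δᵐᵒᵖ N] : Module Δᵐᵒᵖ (BalancedTensor Γ M N) :=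
  Module.compHom _ (rightAction Γ (M := M) (N := N) Δᵐᵒᵖ)

@[simp]
theorem left_smul_tmul {Λ : Type v₆} [Ring Λ] [Module Λ M] [SMulCommClass Λ Γᵐᵒᵖ M]
    (s : Λ) (m : M) (n : N) : s • tmul Γ m n = tmul Γ (s • m) n := rfl

@[simp]
theorem right_smul_tmul {Δ : Type v₆} [Ring Δ] [Module Δᵐᵒᵖ N] [SMulCommClass Γ Δᵐᵒᵖ N]
    (s : Δᵐᵒᵖ) (m : M) (n : N) : s • tmul Γ m n = tmul Γ m (s • n) := rfl

instance instSMulCommClass {Λ : Type v₆} [Ring Λ] [Module Λ M] [SMulCommClass Λ Γᵐᵒᵖ M]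
    {Δ : Type v₇} [Ring Δ] [Module Δᵐᵒᵖ N] [SMulCommClass Γ Δᵐᵒᵖ N] :
    SMulCommClass Λ Δᵐᵒᵖ (BalancedTensor Γ M N) where
  smul_comm s t x := by
    have h : (leftAction Γ (M := M) (N := N) Λ s).comp (rightAction Γ (M := M) (N := N) Δᵐᵒᵖ t) =
        (rightAction Γ (M := M) (N := N) Δᵐᵒᵖ t).comp (leftAction Γ (M := M) (N := N) Λ s) :=
      hom_ext Γ fun m n => rfl
    exact DFunLike.congr_fun h x

/-- `M ⊗_Γ g` as a map of left `Λ`-modules. -/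
noncomputable def lTensor {Λ : Type v₆} [Ring Λ] (M : Type v₂) [AddCommGroup M] [Module Γᵐᵒᵖ M]
    [Module Λ M] [SMulCommClass Λ Γᵐᵒᵖ M] (g : N →ₗ[Γ] N') :
    BalancedTensor Γ M N →ₗ[Λ] BalancedTensor Γ M N' where
  toFun := map Γ LinearMap.id g
  map_add' := map_add _
  map_smul' s x := by
    have h : (map Γ (LinearMap.id : M →ₗ[Γᵐᵒᵖ] M) g).comp (leftAction Γ (M := M) (N := N) Λ s) =
        (leftAction Γ (M := M) (N := N') Λ s).comp (map Γ LinearMap.id g) :=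
      hom_ext Γ fun m n => rfl
    exact DFunLike.congr_fun h x

end BalancedTensor

end BalancedTensor

universe u w

/-- The functor `M ⊗_Γ - : Mod Γ ⥤ Mod Λ` defined by a `(Λ, Γ)`-bimodule `M`. -/
noncomputable def bimoduleTensorFunctor (Λ Γ : Type u) [Ring Λ] [Ring Γ] (M : Type u)
    [AddCommGroup M] [Module Λ M] [Module Γᵐᵒᵖ M] [SMulCommClass Λ Γᵐᵒᵖ M] :
    ModuleCat.{u} Γ ⥤ ModuleCat.{u} Λ where
  obj V := ModuleCat.of Λ (BalancedTensor Γ M V)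
  map f := ModuleCat.ofHom (BalancedTensor.lTensor Γ M f.hom)
  map_id V := by
    ext x
    exact DFunLike.congr_fun (BalancedTensor.hom_ext Γ (M := M) (N := V)
      (f := BalancedTensor.map Γ LinearMap.id LinearMap.id) (g := AddMonoidHom.id _)
      fun m n => rfl) x
  map_comp {V W Z} f g := by
    ext x
    exact DFunLike.congr_fun (BalancedTensor.hom_ext Γ (M := M) (N := V)
      (f := BalancedTensor.map Γ LinearMap.id (g.hom ∘ₗ f.hom))
      (g := (BalancedTensor.map Γ LinearMap.id g.hom).comp
        (BalancedTensor.map Γ LinearMap.id f.hom)) fun m n => rfl) x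

/-- `M` and `M'` are isomorphic as `(Λ, Γ)`-bimodules. -/
def BimoduleIso (Λ Γ : Type u) [Ring Λ] [Ring Γ] (M M' : Type u)
    [AddCommGroup M] [Module Λ M] [Module Γᵐᵒᵖ M]
    [AddCommGroup M'] [Module Λ M'] [Module Γᵐᵒᵖ M'] : Prop :=
  ∃ e : M ≃ₗ[Λ] M', ∀ (c : Γᵐᵒᵖ) (m : M), e (c • m) = c • e m

/-- `N ∣ M` for `(Λ, Γ)`-bimodules: `M ≅ N ⊕ X` as bimodules for some bimodule `X`. -/
def IsBimoduleSummand (Λ Γ : Type u) [Ring Λ] [Ring Γ] (N M : Type u)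
    [AddCommGroup N] [Module Λ N] [Module Γᵐᵒᵖ N]
    [AddCommGroup M] [Module Λ M] [Module Γᵐᵒᵖ M] : Prop :=
  ∃ (X : Type u) (_ : AddCommGroup X) (_ : Module Λ X) (_ : Module Γᵐᵒᵖ X)
    (_ : SMulCommClass Λ Γᵐᵒᵖ X), BimoduleIso Λ Γ M (N × X)

/-- A `Λ`-bimodule `T` is centrally projective over `Λ` if it lies in `add` of the bimodule `Λ`,
i.e. it is a bimodule direct summand of a finite direct sum of copies of `Λ`. -/
def IsCentrallyProjective (Λ : Type u) [Ring Λ] (T : Type u)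
    [AddCommGroup T] [Module Λ T] [Module Λᵐᵒᵖ T] : Prop :=
  ∃ n : ℕ, IsBimoduleSummand Λ Λ T (Fin n → Λ)

/-- `Λ` and `Γ` are separably equivalent, induced by the bimodules `M` and `N`. -/
structure SeparablyEquivalentBy (Λ Γ : Type u) [Ring Λ] [Ring Γ] (M N : Type u)
    [AddCommGroup M] [Module Λ M] [Module Γᵐᵒᵖ M] [SMulCommClass Λ Γᵐᵒᵖ M]
    [AddCommGroup N] [Module Γ N] [Module Λᵐᵒᵖ N] [SMulCommClass Γ Λᵐᵒᵖ N] : Prop where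
  finite_left_M : Module.Finite Λ M
  projective_left_M : Module.Projective Λ M
  finite_right_M : Module.Finite Γᵐᵒᵖ M
  projective_right_M : Module.Projective Γᵐᵒᵖ M
  finite_left_N : Module.Finite Γ N
  projective_left_N : Module.Projective Γ N
  finite_right_N : Module.Finite Λᵐᵒᵖ N
  projective_right_N : Module.Projective Λᵐᵒᵖ N
  summand_left : IsBimoduleSummand Λ Λ Λ (BalancedTensor Γ M N)
  summand_right : IsBimoduleSummand Γ Γ Γ (BalancedTensor Λ N M)

/-- `Λ` and `Γ` are symmetrically separably equivalent, induced by the bimodules `M` and `N`. -/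
structure SymmetricallySeparablyEquivalentBy (Λ Γ : Type u) [Ring Λ] [Ring Γ] (M N : Type u)
    [AddCommGroup M] [Module Λ M] [Module Γᵐᵒᵖ M] [SMulCommClass Λ Γᵐᵒᵖ M]
    [AddCommGroup N] [Module Γ N] [Module Λᵐᵒᵖ N] [SMulCommClass Γ Λᵐᵒᵖ N] : Prop
    extends SeparablyEquivalentBy Λ Γ M N where
  adj_MN : Nonempty (bimoduleTensorFunctor Λ Γ M ⊣ bimoduleTensorFunctor Γ Λ N)
  adj_NM : Nonempty (bimoduleTensorFunctor Γ Λ N ⊣ bimoduleTensorFunctor Λ Γ M)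

/-- A minimal injective coresolution `0 → A → I⁰ → I¹ → ⋯` of the left module `A` over `A`:
an exact sequence with injective terms in which every term is an essential extension of the
image of the incoming map. -/
structure MinimalInjectiveCoresolution (A : Type u) [Ring A] where
  I : ℕ → ModuleCat.{u} A
  injective_I : ∀ n, Module.Injective A (I n)
  ε : A →ₗ[A] I 0
  d : ∀ n, I n →ₗ[A] I (n + 1)
  ε_injective : Function.Injective ε
  exact_zero : Function.Exact ε (d 0)
  exact_succ : ∀ n, Function.Exact (d n) (d (n + 1))
  essential_zero : ∀ S : Submodule A (I 0), S ⊓ LinearMap.range ε = ⊥ → S = ⊥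
  essential_succ : ∀ n, ∀ S : Submodule A (I (n + 1)), S ⊓ LinearMap.range (d n) = ⊥ → S = ⊥

/-- The dominant dimension of `A`: the least `n` such that the `n`-th term `Iⁿ` of the minimal
injective coresolution of the left module `A` is not projective, and `∞` if there is no such `n`.
(Minimal injective coresolutions exist and are unique up to isomorphism, so the infimum over all
of them involves no choice.) -/
noncomputable def domDim (A : Type u) [Ring A] : ℕ∞ :=
  ⨅ (C : MinimalInjectiveCoresolution A) (n : ℕ) (_ : ¬ Module.Projective A (C.I n)), (n : ℕ∞)

/-- The (left) global dimension (`⊥` for the zero ring). -/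
noncomputable def glDim (A : Type u) [Ring A] : WithBot ℕ∞ :=
  ⨆ X : ModuleCat.{u} A, projectiveDimension X

/-- `V` is an Auslander generator: a finitely generated module such that every finitely generated
module is a quotient of some `Vⁿ` (generator) and a submodule of some `Vⁿ` (cogenerator). -/
structure IsAuslanderGenerator (Λ : Type u) [Ring Λ] (V : ModuleCat.{u} Λ) : Prop where
  finite : Module.Finite Λ V
  generator : ∀ X : ModuleCat.{u} Λ, Module.Finite Λ X →
    ∃ (n : ℕ) (f : (Fin n → V) →ₗ[Λ] X), Function.Surjective f
  cogenerator : ∀ X : ModuleCat.{u} Λ, Module.Finite Λ X →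
    ∃ (n : ℕ) (f : X →ₗ[Λ] (Fin n → V)), Function.Injective f

/-- The endomorphism ring of a left module `V`, acting on `V` from the right (so that
`Hom_Λ(V, -)` takes values in left modules over it). As `Module.End Λ V` has `f * g = f ∘ g`,
this is the opposite of it. -/
abbrev EndAlg (Λ : Type u) [Ring Λ] (V : ModuleCat.{u} Λ) : Type u := (Module.End Λ V)ᵐᵒᵖ

/-- The rigidity dimension: the supremum of the dominant dimensions of the endomorphism algebras
of all Auslander generators. -/
noncomputable def rigDim (Λ : Type u) [Ring Λ] : ℕ∞ :=
  ⨆ (V : ModuleCat.{u} Λ) (_ : IsAuslanderGenerator Λ V), domDim (EndAlg Λ V)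

/-- The variant of the rigidity dimension in which only those Auslander generators are admitted
whose endomorphism algebra has finite global dimension. -/
noncomputable def rigDimFin (Λ : Type u) [Ring Λ] : ℕ∞ :=
  ⨆ (V : ModuleCat.{u} Λ) (_ : IsAuslanderGenerator Λ V) (_ : glDim (EndAlg Λ V) < ⊤),
    domDim (EndAlg Λ V)

/-- The representation dimension: the infimum of the global dimensions of the endomorphism
algebras of all Auslander generators. -/
noncomputable def repDim (Λ : Type u) [Ring Λ] : WithBot ℕ∞ :=
  ⨅ (V : ModuleCat.{u} Λ) (_ : IsAuslanderGenerator Λ V), glDim (EndAlg Λ V)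

/-! ### Injective hulls and comparison of injective coresolutions -/

section InjectiveHull

variable {A : Type u} [Ring A]

/-! Put `F = N ⊗_Λ -` and `G = M ⊗_Γ -`, adjoint to each other on both sides. For an Auslander
generator `V` over `Λ` the claim is that `FV` is an Auslander generator over `Γ` and that, with `A =
End V` and `B = End FV`, `dom.dim A ≤ dom.dim B` and `gl.dim B ≤ gl.dim A`. Exchanging the roles of
`Λ` and `Γ` then gives all the equalities.

The summand `Γ` of `N ⊗_Λ M` makes the identity a natural retract of `FG`. Since `F` preserves
epimorphisms and monomorphisms, `FV` is an Auslander generator (`IsAuslanderGenerator.map`). Central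
projectivity of `M ⊗_Γ N` makes `GFV` a direct summand of some `V^k`. Together with the two
adjunctions this produces a Frobenius homomorphism `B → A` with dual bases
(`frobeniusSystemOfAdjunctions`); together with the retract it produces a Casimir element that makes
`A → B` separable (`separabilitySystemOfRetract`).

For a Frobenius extension, `Hom_A(B, -)` is exact, preserves injectives and projectives, and sends
`A` to `B`. It therefore carries a minimal injective coresolution of `A` to an injective
coresolution of `B` without losing projective terms (`FrobeniusSystem.domDim_le`). For a separable
extension, a `B`-module that is projective over `A` is projective. Restriction preserves projectives
by the Frobenius property, so dimension shifting bounds the projective dimension over `B` by the one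
over `A` (`SeparabilitySystem.glDim_le`). -/

theorem Module.Injective.of_retract {X Y : Type u} [AddCommGroup X] [Module A X]
    [AddCommGroup Y] [Module A Y] (hY : Module.Injective A Y) (i : X →ₗ[A] Y) (r : Y →ₗ[A] X)
    (h : ∀ x, r (i x) = x) : Module.Injective A X where
  out P Q _ _ _ _ f hf g := by
    obtain ⟨k, hk⟩ := hY.out f hf (i ∘ₗ g)
    exact ⟨r ∘ₗ k, fun x => by simp [hk, h]⟩

/-- Every submodule has a complement up to essential extension: a submodule `C` disjoint from `P`
such that `P` meets every submodule strictly larger than `C`. -/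
theorem Submodule.exists_maximal_disjoint {E : Type u} [AddCommGroup E] [Module A E]
    (P : Submodule A E) : ∃ C : Submodule A E, Maximal (fun C => C ⊓ P = ⊥) C := by
  obtain ⟨C, -, hC⟩ := zorn_le_nonempty₀ {C : Submodule A E | C ⊓ P = ⊥}
    (fun c hc hchain C₀ hC₀ => by
    refine ⟨sSup c, ?_, fun z hz => le_sSup hz⟩
    have hdir : DirectedOn (· ≤ ·) c := hchain.directedOn
    refine (Submodule.eq_bot_iff _).2 ?_
    rintro x ⟨hx, hxP⟩
    obtain ⟨D, hD, hxD⟩ := (Submodule.mem_sSup_of_directed ⟨C₀, hC₀⟩ hdir).1 hx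
    exact (Submodule.eq_bot_iff _).1 (hc hD) x ⟨hxD, hxP⟩) ⊥ (by simp)
  exact ⟨C, hC⟩

/-- A module embeds essentially into an injective submodule of any injective extension. -/
theorem Submodule.exists_injective_essential {E : Type u} [AddCommGroup E] [Module A E]
    (hE : Module.Injective A E) (X : Submodule A E) :
    ∃ P : Submodule A E, X ≤ P ∧ Module.Injective A P ∧
      ∀ S : Submodule A E, S ≤ P → S ⊓ X = ⊥ → S = ⊥ := by
  obtain ⟨P, hXP, hP⟩ := zorn_le_nonempty₀
    {P : Submodule A E | X ≤ P ∧ ∀ S : Submodule A E, S ≤ P → S ⊓ X = ⊥ → S = ⊥}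
    (fun c hc hchain C₀ hC₀ => by
      refine ⟨sSup c, ⟨(hc hC₀).1.trans (le_sSup hC₀), fun S hS hSX => ?_⟩, fun z hz => le_sSup hz⟩
      refine (Submodule.eq_bot_iff _).2 fun x hx => ?_
      obtain ⟨D, hD, hxD⟩ :=
        (Submodule.mem_sSup_of_directed ⟨C₀, hC₀⟩ hchain.directedOn).1 (hS hx)
      have hspan : Submodule.span A {x} ≤ S := (Submodule.span_singleton_le_iff_mem _ _).2 hx
      have := (hc hD).2 _ ((Submodule.span_singleton_le_iff_mem x D).2 hxD)
        (le_bot_iff.1 ((inf_le_inf_right X hspan).trans hSX.le))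
      exact Submodule.span_singleton_eq_bot.1 this)
    X ⟨le_rfl, fun S hS hSX => by rwa [inf_eq_left.2 hS] at hSX⟩
  obtain ⟨hPmem, hPmax⟩ := hP
  -- `P` is a maximal essential extension of `X` inside `E`. It embeds essentially into `E ⧸ C`, so
  -- extending the inclusion of `P` to `h : E ⧸ C → E` gives an injective map. Its range is again
  -- essential over `X`, hence lies in `P`, and `h ∘ C.mkQ` retracts `E` onto `P`.
  obtain ⟨C, hC, hCmax⟩ := Submodule.exists_maximal_disjoint P
  have hinj : Function.Injective (C.mkQ ∘ₗ P.subtype) := by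
    refine (injective_iff_map_eq_zero _).2 fun x hx => ?_
    have hxC : (x : E) ∈ C := by simpa using hx
    exact Subtype.ext ((Submodule.eq_bot_iff _).1 hC x ⟨hxC, x.2⟩)
  obtain ⟨h, hh⟩ := hE.out _ hinj P.subtype
  have hhP : ∀ x ∈ P, h (C.mkQ x) = x := fun x hx => hh ⟨x, hx⟩
  have hess : ∀ T : Submodule A (E ⧸ C), (∀ x ∈ P, C.mkQ x ∈ T → x = 0) → T = ⊥ := by
    intro T hT
    have h1 : C ≤ T.comap C.mkQ := fun x hx => by
      have : C.mkQ x = 0 := by simpa using hx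
      simp [Submodule.mem_comap, this]
    have h2 : T.comap C.mkQ ⊓ P = ⊥ := (Submodule.eq_bot_iff _).2 fun x hx => hT x hx.2 hx.1
    have h3 := hCmax h2 h1
    refine (Submodule.eq_bot_iff _).2 fun y hy => ?_
    obtain ⟨x, rfl⟩ := C.mkQ_surjective y
    simpa using h3 hy
  have hhinj : LinearMap.ker h = ⊥ := hess _ fun x hx hxk => by
    rw [LinearMap.mem_ker, hhP x hx] at hxk; exact hxk
  have hrange : LinearMap.range h ≤ P := by
    refine hPmax ⟨hXP.trans fun x hx => ⟨C.mkQ x, hhP x hx⟩, fun S hS hSX => ?_⟩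
      fun x hx => ⟨C.mkQ x, hhP x hx⟩
    have hSP : S ⊓ P = ⊥ := hPmem.2 _ inf_le_right
      (le_bot_iff.1 ((inf_le_inf_right X inf_le_left).trans hSX.le))
    have hT : S.comap h = ⊥ := hess _ fun x hx hxS => by
      rw [Submodule.mem_comap, hhP x hx] at hxS
      exact (Submodule.eq_bot_iff _).1 hSP x ⟨hxS, hx⟩
    refine (Submodule.eq_bot_iff _).2 fun x hx => ?_
    obtain ⟨y, rfl⟩ := hS hx
    have : y = 0 := (Submodule.eq_bot_iff _).1 hT y hx
    simp [this]
  refine ⟨P, hXP, hE.of_retract P.subtype ((h ∘ₗ C.mkQ).codRestrict P fun x => hrange ⟨_, rfl⟩)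
    fun x => Subtype.ext (hhP x x.2), hPmem.2⟩

theorem ModuleCat.exists_injective_hull (X : ModuleCat.{u} A) :
    ∃ (I : ModuleCat.{u} A) (ι : X →ₗ[A] I), Module.Injective A I ∧ Function.Injective ι ∧
      ∀ S : Submodule A I, S ⊓ LinearMap.range ι = ⊥ → S = ⊥ := by
  let E := CategoryTheory.Injective.under X
  let j : X →ₗ[A] E := (CategoryTheory.Injective.ι X).hom
  have hj : Function.Injective j := (ModuleCat.mono_iff_injective _).1 inferInstance
  have : CategoryTheory.Injective (ModuleCat.of A E) :=
    inferInstanceAs (CategoryTheory.Injective (CategoryTheory.Injective.under X))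
  have hE : Module.Injective A E := Module.injective_module_of_injective_object A E
  obtain ⟨P, hXP, hP, hess⟩ := Submodule.exists_injective_essential hE (LinearMap.range j)
  refine ⟨ModuleCat.of A P, j.codRestrict P fun x => hXP ⟨x, rfl⟩, hP,
    fun x y hxy => hj (congrArg Subtype.val hxy), fun S hS => ?_⟩
  have : S.map P.subtype = ⊥ := hess _ (Submodule.map_subtype_le P S) (by
    refine (Submodule.eq_bot_iff _).2 ?_
    rintro _ ⟨⟨s, hs, rfl⟩, ⟨x, hx⟩⟩
    have := (Submodule.eq_bot_iff _).1 hS s ⟨hs, ⟨x, Subtype.ext hx⟩⟩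
    rw [this]; rfl)
  exact (Submodule.eq_bot_iff _).2 fun s hs =>
    Subtype.ext ((Submodule.eq_bot_iff _).1 this _ ⟨s, hs, rfl⟩)

namespace ModuleCat

/-- An injective hull of a module. -/
noncomputable def injectiveHull (X : ModuleCat.{u} A) : ModuleCat.{u} A :=
  (exists_injective_hull X).choose

/-- The embedding of a module into its injective hull. -/
noncomputable def toInjectiveHull (X : ModuleCat.{u} A) : X →ₗ[A] injectiveHull X :=
  (exists_injective_hull X).choose_spec.choose

theorem injective_injectiveHull (X : ModuleCat.{u} A) : Module.Injective A (injectiveHull X) :=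
  (exists_injective_hull X).choose_spec.choose_spec.1

theorem toInjectiveHull_injective (X : ModuleCat.{u} A) : Function.Injective (toInjectiveHull X) :=
  (exists_injective_hull X).choose_spec.choose_spec.2.1

theorem toInjectiveHull_essential (X : ModuleCat.{u} A) (S : Submodule A (injectiveHull X))
    (hS : S ⊓ LinearMap.range (toInjectiveHull X) = ⊥) : S = ⊥ :=
  (exists_injective_hull X).choose_spec.choose_spec.2.2 S hS

/-- The iterated cosyzygies of a module. -/
noncomputable def cosyzygy (X : ModuleCat.{u} A) : ℕ → ModuleCat.{u} A
  | 0 => X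
  | n + 1 => ModuleCat.of A
      (injectiveHull (cosyzygy X n) ⧸ LinearMap.range (toInjectiveHull (cosyzygy X n)))

/-- The projection of the `n`-th injective hull onto the next cosyzygy. -/
noncomputable def toCosyzygy (X : ModuleCat.{u} A) (n : ℕ) :
    injectiveHull (cosyzygy X n) →ₗ[A] cosyzygy X (n + 1) :=
  (LinearMap.range (toInjectiveHull (cosyzygy X n))).mkQ

theorem range_toCosyzygy (X : ModuleCat.{u} A) (n : ℕ) : LinearMap.range (toCosyzygy X n) = ⊤ :=
  Submodule.range_mkQ _

theorem ker_toCosyzygy (X : ModuleCat.{u} A) (n : ℕ) :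
    LinearMap.ker (toCosyzygy X n) = LinearMap.range (toInjectiveHull (cosyzygy X n)) :=
  Submodule.ker_mkQ _

end ModuleCat

/-- Without existence the infimum defining `domDim` could be empty, hence `⊤`; an actual
coresolution is needed to bound `domDim` from above. -/
theorem MinimalInjectiveCoresolution.nonempty (A : Type u) [Ring A] :
    Nonempty (MinimalInjectiveCoresolution A) := by
  let X := ModuleCat.of A A
  let d (n : ℕ) := ModuleCat.toInjectiveHull (X.cosyzygy (n + 1)) ∘ₗ X.toCosyzygy n
  have hker (n : ℕ) : LinearMap.ker (d n) =
      LinearMap.range (ModuleCat.toInjectiveHull (X.cosyzygy n)) := by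
    rw [LinearMap.ker_comp_of_ker_eq_bot _
      (LinearMap.ker_eq_bot.2 (ModuleCat.toInjectiveHull_injective _)), X.ker_toCosyzygy]
  have hrange (n : ℕ) : LinearMap.range (d n) =
      LinearMap.range (ModuleCat.toInjectiveHull (X.cosyzygy (n + 1))) :=
    LinearMap.range_comp_of_range_eq_top _ (X.range_toCosyzygy n)
  exact ⟨{
    I := fun n => (X.cosyzygy n).injectiveHull
    injective_I := fun n => ModuleCat.injective_injectiveHull _
    ε := ModuleCat.toInjectiveHull X
    d := d
    ε_injective := ModuleCat.toInjectiveHull_injective X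
    exact_zero := fun x => SetLike.ext_iff.1 (hker 0) x
    exact_succ := fun n => LinearMap.exact_iff.2 ((hker (n + 1)).trans (hrange n).symm)
    essential_zero := fun S hS => ModuleCat.toInjectiveHull_essential X S hS
    essential_succ := fun n S hS =>
      ModuleCat.toInjectiveHull_essential _ S ((hrange n) ▸ hS) }⟩

/-- A map into an injective module extends along a map whose kernel it kills. -/
theorem Module.Injective.exists_extension {P Q J : Type u} [AddCommGroup P] [Module A P]
    [AddCommGroup Q] [Module A Q] [AddCommGroup J] [Module A J] (hJ : Module.Injective A J)
    (δ : P →ₗ[A] Q) (h : P →ₗ[A] J) (hker : LinearMap.ker δ ≤ LinearMap.ker h) :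
    ∃ k : Q →ₗ[A] J, k ∘ₗ δ = h := by
  obtain ⟨k, hk⟩ := hJ.out ((LinearMap.ker δ).liftQ δ le_rfl)
    (LinearMap.ker_eq_bot.1 (Submodule.ker_liftQ_eq_bot _ _ _ le_rfl))
    ((LinearMap.ker δ).liftQ h hker)
  exact ⟨k, LinearMap.ext fun x => hk (Submodule.Quotient.mk x)⟩

/-- Comparison of an essential map `δ` with a map `δ'`, both into injective modules. -/
theorem exists_comparison {P Q I J : Type u} [AddCommGroup P] [Module A P]
    [AddCommGroup Q] [Module A Q] [AddCommGroup I] [Module A I] [AddCommGroup J] [Module A J]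
    (hI : Module.Injective A I) (hJ : Module.Injective A J) (δ : P →ₗ[A] I) (δ' : Q →ₗ[A] J)
    (hess : ∀ S : Submodule A I, S ⊓ LinearMap.range δ = ⊥ → S = ⊥)
    (α : P →ₗ[A] Q) (β : Q →ₗ[A] P) (hβα : Function.Surjective (β ∘ₗ α))
    (hα : ∀ x, δ x = 0 → δ' (α x) = 0) (hβ : ∀ x, δ' x = 0 → δ (β x) = 0)
    (h : ∀ x, δ (β (α x)) = 0 → δ x = 0) :
    ∃ (f : I →ₗ[A] J) (g : J →ₗ[A] I), (∀ x, f (δ x) = δ' (α x)) ∧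
      (∀ x, g (δ' x) = δ (β x)) ∧ Function.Bijective (g ∘ₗ f) := by
  obtain ⟨f, hf⟩ := hJ.exists_extension δ (δ' ∘ₗ α) fun x hx => hα x hx
  obtain ⟨g, hg⟩ := hI.exists_extension δ' (δ ∘ₗ β) fun x hx => hβ x hx
  have hf' (x : P) : f (δ x) = δ' (α x) := DFunLike.congr_fun hf x
  have hg' (x : Q) : g (δ' x) = δ (β x) := DFunLike.congr_fun hg x
  refine ⟨f, g, hf', hg', ?_⟩
  have hinj : Function.Injective (g ∘ₗ f) := by
    rw [← LinearMap.ker_eq_bot]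
    refine hess _ ((Submodule.eq_bot_iff _).2 ?_)
    rintro _ ⟨hx, ⟨x, rfl⟩⟩
    refine h x ?_
    rw [← hg', ← hf']
    exact hx
  obtain ⟨r, hr⟩ := hI.out _ hinj LinearMap.id
  -- By surjectivity of `β ∘ α`, each element of the range of `δ` has the form `(g ∘ f) (δ z)`,
  -- which `r` sends to `δ z`. So `ker r` meets that range trivially and essentiality applies. An
  -- injective left inverse forces `g ∘ f` to be surjective.
  have hrinj : Function.Injective r := by
    rw [← LinearMap.ker_eq_bot]
    refine hess _ ((Submodule.eq_bot_iff _).2 ?_)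
    rintro _ ⟨hx, ⟨x, rfl⟩⟩
    obtain ⟨z, rfl⟩ := hβα x
    have h1 : δ ((β ∘ₗ α) z) = (g ∘ₗ f) (δ z) := by simp [hf', hg']
    have h2 := hr (δ z)
    rw [← h1, LinearMap.mem_ker.1 hx] at h2
    rw [h1, ← LinearMap.id_apply (R := A) (δ z), ← h2, map_zero]
  exact ⟨hinj, fun y => ⟨r y, hrinj (hr (r y))⟩⟩

/-- The terms of a minimal injective coresolution are retracts of the terms of every injective
coresolution. -/
theorem MinimalInjectiveCoresolution.exists_retract (C : MinimalInjectiveCoresolution A)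
    (J : ℕ → ModuleCat.{u} A) (hJ : ∀ n, Module.Injective A (J n)) (ε : A →ₗ[A] J 0)
    (d : ∀ n, J n →ₗ[A] J (n + 1)) (hε : Function.Injective ε) (h₀ : Function.Exact ε (d 0))
    (hd : ∀ n, Function.Exact (d n) (d (n + 1))) (n : ℕ) :
    ∃ (f : C.I n →ₗ[A] J n) (g : J n →ₗ[A] C.I n), Function.Bijective (g ∘ₗ f) := by
  -- Exactness turns compatibility with the incoming maps into the kernel conditions that
  -- `exists_comparison` requires of the outgoing ones.
  have key : ∀ {P Q I K I' K' : Type u} [AddCommGroup P] [Module A P] [AddCommGroup Q]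
      [Module A Q] [AddCommGroup I] [Module A I] [AddCommGroup K] [Module A K]
      [AddCommGroup I'] [Module A I'] [AddCommGroup K'] [Module A K']
      (δ : P →ₗ[A] I) (δ' : Q →ₗ[A] K) (e : I →ₗ[A] I') (e' : K →ₗ[A] K')
      (_ : Function.Exact δ e) (_ : Function.Exact δ' e') (α : P →ₗ[A] Q) (β : Q →ₗ[A] P)
      (_ : Function.Surjective (β ∘ₗ α)) (f : I →ₗ[A] K) (g : K →ₗ[A] I)
      (_ : ∀ x, f (δ x) = δ' (α x)) (_ : ∀ x, g (δ' x) = δ (β x))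
      (_ : Function.Bijective (g ∘ₗ f)),
      (∀ x, e x = 0 → e' (f x) = 0) ∧ (∀ x, e' x = 0 → e (g x) = 0) ∧
        ∀ x, e (g (f x)) = 0 → e x = 0 := by
    intro P Q I K I' K' _ _ _ _ _ _ _ _ _ _ _ _ δ δ' e e' hδ hδ' α β hβα f g hf hg hgf
    refine ⟨fun x hx => ?_, fun x hx => ?_, fun x hx => ?_⟩
    · obtain ⟨p, rfl⟩ := (hδ x).1 hx
      rw [hf]; exact (hδ' _).2 ⟨_, rfl⟩
    · obtain ⟨p, rfl⟩ := (hδ' x).1 hx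
      rw [hg]; exact (hδ _).2 ⟨_, rfl⟩
    · obtain ⟨p, hp⟩ := (hδ _).1 hx
      obtain ⟨q, rfl⟩ := hβα p
      have : x = δ q := hgf.1 (by simpa [hf, hg] using hp.symm)
      exact (hδ x).2 ⟨q, this.symm⟩
  -- The kernel conditions on `C.d n` and `d n` are carried along so that the induction can
  -- continue.
  suffices H : ∃ (f : C.I n →ₗ[A] J n) (g : J n →ₗ[A] C.I n), Function.Bijective (g ∘ₗ f) ∧
      (∀ x, C.d n x = 0 → d n (f x) = 0) ∧ (∀ x, d n x = 0 → C.d n (g x) = 0) ∧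
      ∀ x, C.d n (g (f x)) = 0 → C.d n x = 0 by
    obtain ⟨f, g, h, -⟩ := H
    exact ⟨f, g, h⟩
  induction n with
  | zero =>
    obtain ⟨f, g, hf, hg, hgf⟩ := exists_comparison (C.injective_I 0) (hJ 0) C.ε ε
      C.essential_zero LinearMap.id LinearMap.id Function.surjective_id
      (fun x hx => by simp [(map_eq_zero_iff _ C.ε_injective).1 hx])
      (fun x hx => by simp [(map_eq_zero_iff _ hε).1 hx]) (fun x hx => hx)
    exact ⟨f, g, hgf, key _ _ _ _ C.exact_zero h₀ _ _ Function.surjective_id f g hf hg hgf⟩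
  | succ n ih =>
    obtain ⟨f, g, hgf, h1, h2, h3⟩ := ih
    obtain ⟨f', g', hf', hg', hgf'⟩ := exists_comparison (C.injective_I (n + 1)) (hJ (n + 1))
      (C.d n) (d n) (C.essential_succ n) f g hgf.2 h1 h2 h3
    exact ⟨f', g', hgf', key _ _ _ _ (C.exact_succ n) (hd n) _ _ hgf.2 f' g' hf' hg' hgf'⟩

/-- If `A` has an injective coresolution whose `n`-th term is projective, then so is the `n`-th
term of every minimal one. -/
theorem MinimalInjectiveCoresolution.projective_of_coresolution
    (C : MinimalInjectiveCoresolution A)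
    (J : ℕ → ModuleCat.{u} A) (hJ : ∀ n, Module.Injective A (J n)) (ε : A →ₗ[A] J 0)
    (d : ∀ n, J n →ₗ[A] J (n + 1)) (hε : Function.Injective ε) (h₀ : Function.Exact ε (d 0))
    (hd : ∀ n, Function.Exact (d n) (d (n + 1))) (n : ℕ) (hn : Module.Projective A (J n)) :
    Module.Projective A (C.I n) := by
  obtain ⟨f, g, hgf⟩ := C.exists_retract J hJ ε d hε h₀ hd n
  let e := LinearEquiv.ofBijective _ hgf
  exact Module.Projective.of_split f (e.symm.toLinearMap ∘ₗ g) (LinearMap.ext fun x =>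
    e.symm_apply_apply x)

end InjectiveHull

/-! ### Frobenius and separable ring extensions -/

section FrobeniusExtension

variable {A B : Type u} [Ring A] [Ring B]

/-- A Frobenius system for a ring homomorphism `φ : A → B`: a Frobenius homomorphism `E : B → A`
together with a pair of dual bases. -/
structure FrobeniusSystem (φ : A →+* B) where
  n : ℕ
  E : B →+ A
  x : Fin n → B
  y : Fin n → B
  map_mul_right : ∀ a b, E (b * φ a) = E b * a
  map_mul_left : ∀ a b, E (φ a * b) = a * E b
  sum_left : ∀ b, ∑ i, x i * φ (E (y i * b)) = b
  sum_right : ∀ b, ∑ i, φ (E (b * x i)) * y i = b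

/-- A separability system for a ring homomorphism `φ : A → B`: elements with `∑ uᵢ vᵢ = 1` for
which `∑ uᵢ ⊗ vᵢ` is a Casimir element of `B ⊗_A B`, as witnessed by the matrices `c b`. -/
structure SeparabilitySystem (φ : A →+* B) where
  n : ℕ
  u : Fin n → B
  v : Fin n → B
  c : B → Fin n → Fin n → A
  sum_mul : ∑ i, u i * v i = 1
  mul_u : ∀ b i, b * u i = ∑ j, u j * φ (c b j i)
  v_mul : ∀ b j, v j * b = ∑ i, φ (c b j i) * v i

open ModuleCat

namespace ModuleCat.CoextendScalars

variable {φ : A →+* B} {X Y : ModuleCat.{u} A}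

/-- The additive map underlying an element of a coextended module. -/
noncomputable def toAddHom (h : (coextendScalars φ).obj X) : B →+ X :=
  (CoextendScalars.equiv φ X h).toAddMonoidHom

/-- An element of the coextended module, given by an additive map. -/
noncomputable def ofAddHom (h : B →+ X) (hh : ∀ a b, h (φ a * b) = a • h b) :
    (coextendScalars φ).obj X :=
  (CoextendScalars.equiv φ X).symm
    { toFun := fun b => h b
      map_add' := h.map_add
      map_smul' := fun a b => hh a b }

@[simp]
theorem toAddHom_ofAddHom (h : B →+ X) (hh : ∀ a b, h (φ a * b) = a • h b) (b : B) :
    toAddHom (ofAddHom h hh) b = h b := rfl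

@[simp]
theorem toAddHom_smul (h : (coextendScalars φ).obj X) (b c : B) :
    toAddHom (c • h) b = toAddHom h (b * c) := rfl

@[simp]
theorem toAddHom_map (f : X ⟶ Y) (h : (coextendScalars φ).obj X) (b : B) :
    toAddHom ((coextendScalars φ).map f h) b = f (toAddHom h b) := rfl

@[simp]
theorem toAddHom_add (g h : (coextendScalars φ).obj X) :
    toAddHom (g + h) = toAddHom g + toAddHom h := rfl

theorem toAddHom_ext {g h : (coextendScalars φ).obj X}
    (H : ∀ b : B, toAddHom g b = toAddHom h b) : g = h :=
  CoextendScalars.ext (LinearMap.ext H)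

theorem toAddHom_mul (h : (coextendScalars φ).obj X) (a : A) (b : B) :
    toAddHom h (φ a * b) = a • toAddHom h b :=
  (CoextendScalars.equiv φ X h).map_smul a b

end ModuleCat.CoextendScalars

open ModuleCat.CoextendScalars

namespace FrobeniusSystem

variable {φ : A →+* B} (S : FrobeniusSystem φ) {X Y Z : ModuleCat.{u} A}
include S

/-- The `y i` generate `B` as a left `A`-module with coordinates `E (- * x i)`, so an `A`-linear map
on `B` is recovered from finitely many values. -/
theorem apply_eq_sum (h : (coextendScalars φ).obj X) (b : B) :
    toAddHom h b = ∑ i, S.E (b * S.x i) • toAddHom h (S.y i) := by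
  conv_lhs => rw [← S.sum_right b]
  rw [map_sum]
  exact Finset.sum_congr rfl fun i _ => toAddHom_mul h _ _

/-- The element of the coextended module with prescribed values on a dual basis. -/
noncomputable def ofBasis (p : Fin S.n → X) : (coextendScalars φ).obj X :=
  ofAddHom (∑ i, ((smulAddHom A X).flip (p i)).comp (S.E.comp (AddMonoidHom.mulRight (S.x i))))
    (fun a b => by
      simp [AddMonoidHom.finsetSum_apply, mul_assoc, S.map_mul_left, mul_smul, Finset.smul_sum])

theorem ofBasis_apply (p : Fin S.n → X) (b : B) :
    toAddHom (S.ofBasis p) b = ∑ i, S.E (b * S.x i) • p i := by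
  simp [ofBasis, AddMonoidHom.finsetSum_apply]

/-- The dual bases make `B` finitely generated projective as a left `A`-module, so `Hom_A(B, -)` is
exact. -/
theorem exact_map (f : X ⟶ Y) (g : Y ⟶ Z) (h : Function.Exact f g) :
    Function.Exact ((coextendScalars φ).map f) ((coextendScalars φ).map g) := by
  intro k
  constructor
  · intro hk
    have (i : Fin S.n) : ∃ p, f p = toAddHom k (S.y i) := (h _).1 (by
      rw [← toAddHom_map, hk]; rfl)
    choose p hp using this
    -- The element `S.ofBasis p` need not take the value `p i` at `y i`; only its image under `f`
    -- has to agree with `k`.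
    refine ⟨S.ofBasis p, toAddHom_ext fun b => ?_⟩
    rw [toAddHom_map, S.ofBasis_apply, S.apply_eq_sum k b, map_sum]
    exact Finset.sum_congr rfl fun i _ => by rw [map_smul, hp]
  · rintro ⟨l, rfl⟩
    refine toAddHom_ext fun b => ?_
    rw [toAddHom_map, toAddHom_map]
    exact (h _).2 ⟨_, rfl⟩

theorem surjective_map (f : X ⟶ Y) (hf : Function.Surjective f) :
    Function.Surjective ((coextendScalars φ).map f) := by
  intro k
  choose p hp using fun i => hf (toAddHom k (S.y i))
  refine ⟨S.ofBasis p, toAddHom_ext fun b => ?_⟩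
  rw [toAddHom_map, S.ofBasis_apply, S.apply_eq_sum k b, map_sum]
  exact Finset.sum_congr rfl fun i _ => by rw [map_smul, hp]

theorem preservesEpimorphisms :
    (coextendScalars φ : ModuleCat.{u} A ⥤ ModuleCat.{u} B).PreservesEpimorphisms where
  preserves f _ := (ModuleCat.epi_iff_surjective _).2
    (S.surjective_map f ((ModuleCat.epi_iff_surjective _).1 inferInstance))

/-- Restriction is left adjoint to coextension, which preserves epimorphisms here. -/
theorem projective_restrictScalars (P : ModuleCat.{u} B) [Projective P] :
    Projective ((restrictScalars φ).obj P) :=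
  haveI := S.preservesEpimorphisms
  (restrictCoextendScalarsAdj.{u} φ).map_projective P inferInstance

omit S in
theorem injective_map (f : X ⟶ Y) (hf : Function.Injective f) :
    Function.Injective ((coextendScalars φ).map f) := fun g h hgh =>
  toAddHom_ext fun b => hf (by rw [← toAddHom_map, hgh, toAddHom_map])

omit S in
theorem injective_coextendScalars (J : ModuleCat.{u} A) (hJ : Module.Injective A J) :
    Module.Injective B ((coextendScalars φ).obj J) := by
  have : CategoryTheory.Injective J := Module.injective_object_of_injective_module A J
  have := (restrictCoextendScalarsAdj.{u} φ).map_injective J inferInstance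
  have : CategoryTheory.Injective (ModuleCat.of B ((coextendScalars φ).obj J)) := this
  exact Module.injective_module_of_injective_object B _

/-- The functional `b ↦ E(b) p` as an element of the coextended module. -/
noncomputable def evalFrobenius (p : X) : (coextendScalars φ).obj X :=
  ofAddHom (((smulAddHom A X).flip p).comp S.E) (fun a b => by simp [S.map_mul_left, mul_smul])

theorem evalFrobenius_apply (p : X) (b : B) :
    toAddHom (S.evalFrobenius p) b = S.E b • p := rfl

/-- The unit of the adjunction making coextension left adjoint to restriction. -/
noncomputable def coextendUnit (X : ModuleCat.{u} A) :
    X →ₛₗ[φ] (coextendScalars φ).obj X where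
  toFun := S.evalFrobenius
  map_add' p q := toAddHom_ext fun b => by
    rw [toAddHom_add, AddMonoidHom.add_apply]
    simp only [evalFrobenius_apply, smul_add]
  map_smul' a p := toAddHom_ext fun b => by
    rw [toAddHom_smul]
    simp only [evalFrobenius_apply, S.map_mul_right, mul_smul]

/-- The `B`-linear map out of a coextended module corresponding to an `A`-linear map. -/
noncomputable def coextendDesc {Z : Type u} [AddCommGroup Z] [Module B Z] (g : X →ₛₗ[φ] Z) :
    (coextendScalars φ).obj X →ₗ[B] Z where
  toFun h := ∑ i, S.x i • g (toAddHom h (S.y i))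
  map_add' h k := by
    simp_rw [toAddHom_add, AddMonoidHom.add_apply, map_add, smul_add, Finset.sum_add_distrib]
  map_smul' c h := by
    have key (i : Fin S.n) : g (toAddHom (c • h) (S.y i)) =
        ∑ j, φ (S.E (S.y i * c * S.x j)) • g (toAddHom h (S.y j)) := by
      rw [toAddHom_smul, S.apply_eq_sum h, map_sum]
      exact Finset.sum_congr rfl fun j _ => LinearMap.map_smulₛₗ g _ _
    simp_rw [key, Finset.smul_sum, smul_smul]
    rw [Finset.sum_comm]
    refine Finset.sum_congr rfl fun j _ => ?_
    -- The coefficient of `g (h (y j))` is now `∑ i, x i * φ (E (y i * c * x j))`, which `sum_left`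
    -- collapses to `c * x j`.
    rw [← Finset.sum_smul]
    simp_rw [mul_assoc (S.y _) c, S.sum_left]
    rfl

omit S in
theorem _root_.Module.Projective.exists_semilinear_lift {P Z W : Type u} [AddCommGroup P]
    [Module A P] [AddCommGroup Z] [Module B Z] [AddCommGroup W] [Module B W]
    (hP : Module.Projective A P) (f : Z →ₗ[B] W) (hf : Function.Surjective f)
    (v : P →ₛₗ[φ] W) : ∃ g : P →ₛₗ[φ] Z, ∀ p, f (g p) = v p := by
  let iZ : Module A Z := Module.compHom Z φ
  let iW : Module A W := Module.compHom W φ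
  let f' : Z →ₗ[A] W := { f with map_smul' := fun a z => f.map_smul (φ a) z }
  let v' : P →ₗ[A] W := { v with map_smul' := fun a z => LinearMap.map_smulₛₗ v a z }
  obtain ⟨g, hg⟩ := Module.projective_lifting_property f' v' hf
  exact ⟨{ toFun := g, map_add' := g.map_add, map_smul' := fun a p => g.map_smul a p },
    fun p => DFunLike.congr_fun hg p⟩

/-- The Frobenius homomorphism makes coextension left adjoint to restriction as well, and
restriction preserves surjections. Concretely, the unit is lifted through `f` over `A` and the lift
is transposed to a `B`-linear section of `f`. -/
theorem projective_coextendScalars (P : ModuleCat.{u} A) (hP : Module.Projective A P) :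
    Module.Projective B ((coextendScalars φ).obj P) := by
  refine Module.Projective.of_lifting_property'' fun f hf => ?_
  obtain ⟨g, hg⟩ := hP.exists_semilinear_lift f hf (S.coextendUnit P)
  refine ⟨S.coextendDesc g, LinearMap.ext fun h => toAddHom_ext fun b => ?_⟩
  have h1 : (f ∘ₗ S.coextendDesc g) h = ∑ i, S.x i • S.evalFrobenius (toAddHom h (S.y i)) := by
    change f (∑ i, S.x i • g (toAddHom h (S.y i))) = _
    simp_rw [map_sum, map_smul, hg]
    rfl
  rw [h1, LinearMap.id_apply, S.apply_eq_sum h b]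
  let ev : (coextendScalars φ).obj P →+ P :=
    { toFun := fun k => toAddHom k b, map_zero' := rfl, map_add' := fun _ _ => rfl }
  refine (map_sum ev _ _).trans (Finset.sum_congr rfl fun i _ => ?_)
  exact (toAddHom_smul _ _ _).trans (S.evalFrobenius_apply _ _)

/-- The functional `E(- b)` as an element of the coextended regular module. -/
noncomputable def regularFunctional (b : B) : (coextendScalars φ).obj (ModuleCat.of A A) :=
  ofAddHom (X := ModuleCat.of A A) (S.E.comp (AddMonoidHom.mulRight b)) (fun a c => by
    simp [mul_assoc, S.map_mul_left])

/-- The coextension of the regular module is the regular module. -/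
noncomputable def coextendRegular :
    B ≃ₗ[B] (coextendScalars φ).obj (ModuleCat.of A A) where
  toFun := S.regularFunctional
  map_add' b c := toAddHom_ext fun z =>
    (congrArg S.E (mul_add z b c)).trans (map_add S.E _ _)
  map_smul' b c := toAddHom_ext fun z => congrArg S.E (mul_assoc z b c).symm
  invFun h := ∑ i, S.x i * φ (toAddHom h (S.y i))
  left_inv b := S.sum_left b
  right_inv h := toAddHom_ext fun b => by
    refine Eq.trans ?_ (S.apply_eq_sum h b).symm
    change S.E (b * ∑ i, S.x i * φ (toAddHom h (S.y i))) = _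
    rw [Finset.mul_sum, map_sum]
    refine Finset.sum_congr rfl fun i _ => ?_
    rw [← mul_assoc, S.map_mul_right]
    rfl

/-- The coextended coresolution of `B` need not be minimal; `projective_of_coresolution` passes from
it to a minimal one. -/
theorem domDim_le : domDim A ≤ domDim B := by
  refine le_iInf fun C => le_iInf fun n => le_iInf fun hn => ?_
  obtain ⟨D⟩ := MinimalInjectiveCoresolution.nonempty A
  refine iInf_le_of_le D (iInf_le_of_le n (iInf_le_of_le (fun hD => hn ?_) le_rfl))
  let ε : ModuleCat.of A A ⟶ D.I 0 := ModuleCat.ofHom D.ε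
  let d (k : ℕ) : D.I k ⟶ D.I (k + 1) := ModuleCat.ofHom (D.d k)
  refine C.projective_of_coresolution (fun k => (coextendScalars φ).obj (D.I k))
    (fun k => injective_coextendScalars _ (D.injective_I k))
    (((coextendScalars φ).map ε).hom ∘ₗ S.coextendRegular.toLinearMap)
    (fun k => ((coextendScalars φ).map (d k)).hom)
    ((injective_map ε D.ε_injective).comp S.coextendRegular.injective) ?_
    (fun k => S.exact_map (d k) (d (k + 1)) (D.exact_succ k)) n
    (S.projective_coextendScalars _ hD)
  have := S.exact_map ε (d 0) D.exact_zero
  exact fun x => (this x).trans ⟨fun ⟨y, hy⟩ => ⟨S.coextendRegular.symm y,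
    (congrArg _ (S.coextendRegular.apply_symm_apply y)).trans hy⟩,
    fun ⟨y, hy⟩ => ⟨S.coextendRegular y, hy⟩⟩

end FrobeniusSystem

/-! ### Separable extensions and global dimension -/

namespace SeparabilitySystem

variable {φ : A →+* B} (T : SeparabilitySystem φ)
include T

/-- The `B`-linear average of an `A`-linear map. -/
noncomputable def average {Y Z : Type u} [AddCommGroup Y] [Module B Y] [AddCommGroup Z]
    [Module B Z] (f : Y →+ Z) (hf : ∀ a y, f (φ a • y) = φ a • f y) : Y →ₗ[B] Z where
  toFun y := ∑ i, T.u i • f (T.v i • y)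
  map_add' y z := by simp_rw [smul_add, map_add, smul_add, Finset.sum_add_distrib]
  map_smul' b y := by
    simp_rw [RingHom.id_apply, Finset.smul_sum, smul_smul, T.mul_u, T.v_mul, Finset.sum_smul,
      map_sum, Finset.smul_sum, mul_smul, hf]
    exact Finset.sum_comm

/-- An `A`-linear section of a projective presentation is averaged over the Casimir element. As `π`
is `B`-linear and `∑ u i * v i = 1`, the average is still a section. -/
theorem projective_of_restrictScalars (Y : ModuleCat.{u} B)
    (hY : Projective ((restrictScalars φ).obj Y)) : Projective Y := by
  let π := Projective.π Y
  have : Epi ((restrictScalars φ).map π) := inferInstance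
  let σ := Projective.factorThru (𝟙 ((restrictScalars φ).obj Y)) ((restrictScalars φ).map π)
  have hσ : σ ≫ (restrictScalars φ).map π = 𝟙 _ := Projective.factorThru_comp _ _
  let P : ModuleCat.{u} B := Projective.over Y
  let f : Y →+ P := σ.hom.toAddMonoidHom
  have hf (y : Y) : π (f y) = y := DFunLike.congr_fun (congrArg ModuleCat.Hom.hom hσ) y
  let s : Y ⟶ P := ModuleCat.ofHom (T.average f fun a y =>
    σ.hom.map_smul a (show (restrictScalars φ).obj Y from y))
  have hs : s ≫ π = 𝟙 Y := by
    ext y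
    change π (∑ i, T.u i • f (T.v i • y)) = y
    simp_rw [map_sum, map_smul, hf, smul_smul, ← Finset.sum_smul, T.sum_mul, one_smul]
  have : Projective P := Projective.projective_over Y
  exact (Retract.mk (Y := P) s π hs).projective

theorem hasProjectiveDimensionLT (S : FrobeniusSystem φ) (n : ℕ) (Y : ModuleCat.{u} B)
    (hY : HasProjectiveDimensionLT ((restrictScalars φ).obj Y) n) :
    HasProjectiveDimensionLT Y n := by
  -- The index bounds the dimension strictly: `0` means zero and `1` means projective. The syzygy
  -- step only relates `n + 2` to `n + 1`, so both base cases are needed.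
  match n with
  | 0 =>
    rw [hasProjectiveDimensionLT_zero_iff_isZero] at hY ⊢
    have := (ModuleCat.isZero_iff_subsingleton).1 hY
    exact (ModuleCat.isZero_iff_subsingleton).2 this
  | 1 =>
    rw [← projective_iff_hasProjectiveDimensionLT_one] at hY ⊢
    exact T.projective_of_restrictScalars Y hY
  | n + 2 =>
    let K := ShortComplex.mk (Limits.kernel.ι (Projective.π Y)) (Projective.π Y)
      (Limits.kernel.condition _)
    have hK : K.ShortExact :=
      { exact := ShortComplex.exact_kernel _
        mono_f := inferInstanceAs (Mono (Limits.kernel.ι (Projective.π Y)))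
        epi_g := inferInstanceAs (Epi (Projective.π Y)) }
    have hK' : (K.map (restrictScalars.{u} φ)).ShortExact :=
      { exact := by
          have := hK.exact
          rw [ShortComplex.ShortExact.moduleCat_exact_iff_function_exact] at this ⊢
          exact this
        mono_f := (ModuleCat.mono_iff_injective _).2 hK.moduleCat_injective_f
        epi_g := (ModuleCat.epi_iff_surjective _).2 hK.moduleCat_surjective_g }
    have h₂ : Projective (K.map (restrictScalars.{u} φ)).X₂ :=
      S.projective_restrictScalars (Projective.over Y)
    exact (hK.hasProjectiveDimensionLT_X₃_iff n (Projective.projective_over Y)).2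
      (hasProjectiveDimensionLT S (n + 1) _
        ((hK'.hasProjectiveDimensionLT_X₃_iff n h₂).1 hY))

theorem glDim_le (S : FrobeniusSystem φ) : glDim B ≤ glDim A := by
  refine iSup_le fun Y => le_trans ?_ (le_iSup _ ((restrictScalars φ).obj Y))
  -- Projective dimension is an infimum of upper bounds, and every bound for the restriction of `Y`
  -- is one for `Y`.
  exact sInf_le_sInf fun d hd i hi => T.hasProjectiveDimensionLT S i Y (hd i hi)

end SeparabilitySystem

end FrobeniusExtension

/-! ### The extension `End V → End FV` and transport of Auslander generators -/

section EndomorphismRings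

variable {Λ Γ : Type u} [Ring Λ] [Ring Γ]

/-- Endomorphisms of `V` in the category of modules, as elements of the endomorphism ring acting
from the right. -/
def endAlgEquiv (V : ModuleCat.{u} Λ) : (V ⟶ V) ≃+ EndAlg Λ V where
  toFun f := MulOpposite.op f.hom
  invFun a := ModuleCat.ofHom a.unop
  left_inv _ := rfl
  right_inv _ := rfl
  map_add' _ _ := rfl

theorem endAlgEquiv_comp {V : ModuleCat.{u} Λ} (f g : V ⟶ V) :
    endAlgEquiv V (f ≫ g) = endAlgEquiv V f * endAlgEquiv V g := rfl

theorem endAlgEquiv_id (V : ModuleCat.{u} Λ) : endAlgEquiv V (𝟙 V) = 1 := rfl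

theorem endAlgEquiv_symm_mul {V : ModuleCat.{u} Λ} (a b : EndAlg Λ V) :
    (endAlgEquiv V).symm (a * b) = (endAlgEquiv V).symm a ≫ (endAlgEquiv V).symm b := rfl

variable (F : ModuleCat.{u} Λ ⥤ ModuleCat.{u} Γ) [F.Additive]

/-- The ring homomorphism between endomorphism rings induced by an additive functor. -/
def Functor.mapEndAlg (V : ModuleCat.{u} Λ) : EndAlg Λ V →+* EndAlg Γ (F.obj V) where
  toFun a := endAlgEquiv _ (F.map ((endAlgEquiv V).symm a))
  map_one' := by rw [← endAlgEquiv_id, AddEquiv.symm_apply_apply, F.map_id]; rfl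
  map_mul' a b := by rw [endAlgEquiv_symm_mul, F.map_comp, endAlgEquiv_comp]
  map_zero' := by rw [map_zero, F.map_zero, map_zero]
  map_add' a b := by rw [map_add, F.map_add, map_add]

variable {F} {G : ModuleCat.{u} Γ ⥤ ModuleCat.{u} Λ} [G.Additive]

/-- If `F` and `G` are adjoint on both sides and `GFV` is a summand of a power of `V`, then
`End V → End FV` is a Frobenius extension. -/
noncomputable def frobeniusSystemOfAdjunctions (adj : F ⊣ G) (adj' : G ⊣ F) (V : ModuleCat.{u} Λ)
    (k : ℕ) (p : Fin k → (G.obj (F.obj V) ⟶ V)) (q : Fin k → (V ⟶ G.obj (F.obj V)))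
    (hpq : ∑ i, p i ≫ q i = 𝟙 _) : FrobeniusSystem (Functor.mapEndAlg F V) where
  n := k
  E := (endAlgEquiv V).toAddMonoidHom.comp
    (((Preadditive.leftComp _ (adj.unit.app V)).comp
      ((Preadditive.rightComp _ (adj'.counit.app V)).comp G.mapAddHom)).comp
        (endAlgEquiv (F.obj V)).symm.toAddMonoidHom)
  -- The decomposition `∑ p i ≫ q i = 𝟙` of `GFV` is transposed through the two adjunctions: `p i`
  -- along `G ⊣ F` and `q i` along `F ⊣ G`.
  x i := endAlgEquiv _ (adj'.unit.app (F.obj V) ≫ F.map (p i))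
  y i := endAlgEquiv _ (F.map (q i) ≫ adj.counit.app (F.obj V))
  map_mul_right a b := by
    obtain ⟨f, rfl⟩ := (endAlgEquiv V).surjective a
    obtain ⟨g, rfl⟩ := (endAlgEquiv _).surjective b
    refine Eq.trans ?_ (endAlgEquiv_comp _ _)
    refine congrArg (endAlgEquiv V) (?_ : adj.unit.app V ≫ G.map (g ≫ F.map f) ≫ adj'.counit.app V
      = (adj.unit.app V ≫ G.map g ≫ adj'.counit.app V) ≫ f)
    simp
  map_mul_left a b := by
    obtain ⟨f, rfl⟩ := (endAlgEquiv V).surjective a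
    obtain ⟨g, rfl⟩ := (endAlgEquiv _).surjective b
    refine Eq.trans ?_ (endAlgEquiv_comp _ _)
    refine congrArg (endAlgEquiv V) (?_ : adj.unit.app V ≫ G.map (F.map f ≫ g) ≫ adj'.counit.app V
      = f ≫ (adj.unit.app V ≫ G.map g ≫ adj'.counit.app V))
    simp
  sum_left b := by
    obtain ⟨g, rfl⟩ := (endAlgEquiv _).surjective b
    -- Naturality and a triangle identity of `adj` bring `p i` and `q i` together. After summation,
    -- a triangle identity of `adj'` leaves `g`; in `sum_right` the adjunctions swap roles.
    have key (i : Fin k) : (adj'.unit.app (F.obj V) ≫ F.map (p i)) ≫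
        F.map (adj.unit.app V ≫ G.map ((F.map (q i) ≫ adj.counit.app (F.obj V)) ≫ g) ≫
          adj'.counit.app V) =
        adj'.unit.app (F.obj V) ≫ F.map (p i ≫ q i) ≫ F.map (G.map g ≫ adj'.counit.app V) := by
      simp
    refine Eq.trans (map_sum (endAlgEquiv _) _ _).symm (congrArg (endAlgEquiv (F.obj V))
      ((Finset.sum_congr rfl fun i _ => key i).trans ?_))
    rw [← Preadditive.comp_sum, ← Preadditive.sum_comp, ← F.map_sum, hpq]
    simp
  sum_right b := by
    obtain ⟨g, rfl⟩ := (endAlgEquiv _).surjective b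
    have key (i : Fin k) : F.map (adj.unit.app V ≫
          G.map (g ≫ (adj'.unit.app (F.obj V) ≫ F.map (p i))) ≫ adj'.counit.app V) ≫
        (F.map (q i) ≫ adj.counit.app (F.obj V)) =
        F.map (adj.unit.app V ≫ G.map g) ≫ F.map (p i ≫ q i) ≫ adj.counit.app (F.obj V) := by
      simp
    refine Eq.trans (map_sum (endAlgEquiv _) _ _).symm (congrArg (endAlgEquiv (F.obj V))
      ((Finset.sum_congr rfl fun i _ => key i).trans ?_))
    rw [← Preadditive.comp_sum, ← Preadditive.sum_comp, ← F.map_sum, hpq]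
    simp

/-- If the identity is a retract of `FG` and `GFV` is a summand of a power of `V`, then
`End V → End FV` is a separable extension. -/
noncomputable def separabilitySystemOfRetract (s : 𝟭 _ ⟶ G ⋙ F) (r : G ⋙ F ⟶ 𝟭 _)
    (hsr : s ≫ r = 𝟙 _) (V : ModuleCat.{u} Λ)
    (k : ℕ) (p : Fin k → (G.obj (F.obj V) ⟶ V)) (q : Fin k → (V ⟶ G.obj (F.obj V)))
    (hpq : ∑ i, p i ≫ q i = 𝟙 _) : SeparabilitySystem (Functor.mapEndAlg F V) where
  n := k
  u i := endAlgEquiv _ (s.app (F.obj V) ≫ F.map (p i))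
  v i := endAlgEquiv _ (F.map (q i) ≫ r.app (F.obj V))
  -- These are the matrix entries of `G b` on `GFV` with respect to `p` and `q`. The two Casimir
  -- identities then express naturality of `s` and `r`.
  c b j i := endAlgEquiv V (q j ≫ G.map ((endAlgEquiv _).symm b) ≫ p i)
  sum_mul := by
    have key (i : Fin k) : (s.app (F.obj V) ≫ F.map (p i)) ≫ (F.map (q i) ≫ r.app (F.obj V)) =
        s.app (F.obj V) ≫ F.map (p i ≫ q i) ≫ r.app (F.obj V) := by simp
    refine Eq.trans (map_sum (endAlgEquiv _) _ _).symm (congrArg (endAlgEquiv (F.obj V))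
      ((Finset.sum_congr rfl fun i _ => key i).trans ?_))
    rw [← Preadditive.comp_sum, ← Preadditive.sum_comp, ← F.map_sum, hpq, F.map_id]
    exact (congrArg (s.app (F.obj V) ≫ ·) (Category.id_comp _)).trans
      (NatTrans.congr_app hsr (F.obj V))
  mul_u b i := by
    obtain ⟨g, rfl⟩ := (endAlgEquiv _).surjective b
    have key (j : Fin k) : (s.app (F.obj V) ≫ F.map (p j)) ≫ F.map (q j ≫ G.map g ≫ p i) =
        s.app (F.obj V) ≫ F.map (p j ≫ q j) ≫ F.map (G.map g ≫ p i) := by simp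
    refine Eq.trans (congrArg (endAlgEquiv (F.obj V)) (Eq.trans ?_
      (Finset.sum_congr rfl fun j _ => key j).symm)) (map_sum (endAlgEquiv _) _ _)
    rw [← Preadditive.comp_sum, ← Preadditive.sum_comp, ← F.map_sum, hpq, F.map_id]
    change g ≫ s.app (F.obj V) ≫ F.map (p i) = _
    refine Eq.trans ?_ (congrArg (s.app (F.obj V) ≫ ·) (Category.id_comp _).symm)
    rw [F.map_comp, ← Category.assoc]
    exact (congrArg (· ≫ F.map (p i)) (s.naturality g)).trans (Category.assoc _ _ _)
  v_mul b j := by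
    obtain ⟨g, rfl⟩ := (endAlgEquiv _).surjective b
    have key (i : Fin k) : F.map (q j ≫ G.map g ≫ p i) ≫ (F.map (q i) ≫ r.app (F.obj V)) =
        F.map (q j ≫ G.map g) ≫ F.map (p i ≫ q i) ≫ r.app (F.obj V) := by simp
    refine Eq.trans (congrArg (endAlgEquiv (F.obj V)) (Eq.trans ?_
      (Finset.sum_congr rfl fun j _ => key j).symm)) (map_sum (endAlgEquiv _) _ _)
    rw [← Preadditive.comp_sum, ← Preadditive.sum_comp, ← F.map_sum, hpq, F.map_id]
    change (F.map (q j) ≫ r.app (F.obj V)) ≫ g = _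
    rw [Category.id_comp, F.map_comp, Category.assoc, Category.assoc]
    exact congrArg (F.map (q j) ≫ ·) (r.naturality g).symm

omit [G.Additive] in
/-- Auslander generators are preserved by exact functors that admit the identity as a retract of
a composite. -/
theorem IsAuslanderGenerator.map [F.PreservesEpimorphisms] [F.PreservesMonomorphisms]
    (hF : ∀ X : ModuleCat.{u} Λ, Module.Finite Λ X → Module.Finite Γ (F.obj X))
    (hG : ∀ X : ModuleCat.{u} Γ, Module.Finite Γ X → Module.Finite Λ (G.obj X))
    (s : 𝟭 _ ⟶ G ⋙ F) (r : G ⋙ F ⟶ 𝟭 _) (hsr : s ≫ r = 𝟙 _) {V : ModuleCat.{u} Λ}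
    (hV : IsAuslanderGenerator Λ V) : IsAuslanderGenerator Γ (F.obj V) := by
  have hrs (X : ModuleCat.{u} Γ) (x : X) : r.app X (s.app X x) = x :=
    DFunLike.congr_fun (congrArg ModuleCat.Hom.hom (NatTrans.congr_app hsr X)) x
  have hsum (n : ℕ) : ∑ i : Fin n, ModuleCat.ofHom (LinearMap.proj (R := Λ) (φ := fun _ => V) i) ≫
      ModuleCat.ofHom (LinearMap.single Λ (fun _ : Fin n => V) i) =
        𝟙 (ModuleCat.of Λ (Fin n → V)) := by
    refine ModuleCat.hom_ext (LinearMap.ext fun x => ?_)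
    simpa [ModuleCat.hom_sum, LinearMap.sum_apply] using! Finset.univ_sum_single x
  -- This identity replaces an explicit isomorphism between `F(V^n)` and `(FV)^n`.
  have hsumF (n : ℕ) (t : F.obj (ModuleCat.of Λ (Fin n → V))) :
      ∑ i : Fin n, F.map (ModuleCat.ofHom (LinearMap.single Λ (fun _ : Fin n => V) i))
        (F.map (ModuleCat.ofHom (LinearMap.proj (R := Λ) (φ := fun _ => V) i)) t) = t := by
    have := congrArg F.map (hsum n)
    rw [F.map_sum, F.map_id] at this
    have := DFunLike.congr_fun (congrArg ModuleCat.Hom.hom this) t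
    simpa using this
  refine ⟨hF V hV.finite, fun X hX => ?_, fun X hX => ?_⟩
  · obtain ⟨n, f, hf⟩ := hV.generator (G.obj X) (hG X hX)
    have hf' : Function.Surjective (F.map (ModuleCat.ofHom f)) :=
      have : Epi (ModuleCat.ofHom f) := (ModuleCat.epi_iff_surjective _).2 hf
      (ModuleCat.epi_iff_surjective _).1 inferInstance
    refine ⟨n, ∑ i, ((F.map (ModuleCat.ofHom (LinearMap.single Λ (fun _ : Fin n => V) i)) ≫
      F.map (ModuleCat.ofHom f)) ≫ r.app X).hom ∘ₗ LinearMap.proj i, fun x => ?_⟩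
    -- Covering `s x` suffices, since `r` sends it back to `x`; dually, embedding `X` through `s`
    -- suffices below.
    obtain ⟨t, ht⟩ := hf' (s.app X x)
    refine ⟨fun i => F.map (ModuleCat.ofHom (LinearMap.proj (R := Λ) (φ := fun _ => V) i)) t, ?_⟩
    rw [← hrs X x, ← ht]
    conv_rhs => rw [← hsumF n t, map_sum, map_sum]
    simp
  · obtain ⟨n, f, hf⟩ := hV.cogenerator (G.obj X) (hG X hX)
    have hf' : Function.Injective (F.map (ModuleCat.ofHom f)) :=
      have : Mono (ModuleCat.ofHom f) := (ModuleCat.mono_iff_injective _).2 hf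
      (ModuleCat.mono_iff_injective _).1 inferInstance
    refine ⟨n, LinearMap.pi fun i => ((s.app X ≫ F.map (ModuleCat.ofHom f)) ≫
      F.map (ModuleCat.ofHom (LinearMap.proj (R := Λ) (φ := fun _ => V) i))).hom, ?_⟩
    refine (injective_iff_map_eq_zero _).2 fun x hx => ?_
    have h0 : F.map (ModuleCat.ofHom f) (s.app X x) = 0 := by
      rw [← hsumF n (F.map (ModuleCat.ofHom f) (s.app X x))]
      refine Finset.sum_eq_zero fun i _ => ?_
      rw [← map_zero (F.map (ModuleCat.ofHom (LinearMap.single Λ (fun _ : Fin n => V) i))).hom]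
      exact congrArg _ (congrFun hx i)
    have h1 : s.app X x = 0 := hf' (h0.trans (map_zero _).symm)
    rw [← hrs X x, h1, map_zero]

end EndomorphismRings

/-! ### Comparing the invariants along a pair of functors -/

section Descent

variable {Λ Γ : Type u} [Ring Λ] [Ring Γ]

/-- The hypotheses on a pair of functors under which homological invariants of endomorphism rings
of Auslander generators descend from `Λ` to `Γ`. -/
theorem IsAuslanderGenerator.exists_domDim_le_glDim_le {F : ModuleCat.{u} Λ ⥤ ModuleCat.{u} Γ}
    {G : ModuleCat.{u} Γ ⥤ ModuleCat.{u} Λ} [F.Additive] [G.Additive]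
    (adj : F ⊣ G) (adj' : G ⊣ F)
    (hF : ∀ X : ModuleCat.{u} Λ, Module.Finite Λ X → Module.Finite Γ (F.obj X))
    (hG : ∀ X : ModuleCat.{u} Γ, Module.Finite Γ X → Module.Finite Λ (G.obj X))
    (hFG : ∃ (s : 𝟭 _ ⟶ G ⋙ F) (r : G ⋙ F ⟶ 𝟭 _), s ≫ r = 𝟙 _)
    (hGF : ∀ V : ModuleCat.{u} Λ, ∃ (k : ℕ) (p : Fin k → (G.obj (F.obj V) ⟶ V))
      (q : Fin k → (V ⟶ G.obj (F.obj V))), ∑ i, p i ≫ q i = 𝟙 _)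
    {V : ModuleCat.{u} Λ} (hV : IsAuslanderGenerator Λ V) :
    ∃ W : ModuleCat.{u} Γ, IsAuslanderGenerator Γ W ∧
      domDim (EndAlg Λ V) ≤ domDim (EndAlg Γ W) ∧ glDim (EndAlg Γ W) ≤ glDim (EndAlg Λ V) := by
  obtain ⟨s, r, hsr⟩ := hFG
  obtain ⟨k, p, q, hpq⟩ := hGF V
  -- Being a left and a right adjoint, `F` preserves epimorphisms and monomorphisms.
  have := adj.isLeftAdjoint
  have := adj'.isRightAdjoint
  let S := frobeniusSystemOfAdjunctions adj adj' V k p q hpq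
  exact ⟨F.obj V, hV.map hF hG s r hsr, S.domDim_le,
    (separabilitySystemOfRetract s r hsr V k p q hpq).glDim_le S⟩

/-- For `rigDimFin` both inequalities are needed for the same `W`: the bound on `glDim` keeps `W`
admissible. -/
theorem rigDim_le_of_forall_exists
    (h : ∀ V : ModuleCat.{u} Λ, IsAuslanderGenerator Λ V → ∃ W : ModuleCat.{u} Γ,
      IsAuslanderGenerator Γ W ∧ domDim (EndAlg Λ V) ≤ domDim (EndAlg Γ W) ∧
        glDim (EndAlg Γ W) ≤ glDim (EndAlg Λ V)) :
    rigDim Λ ≤ rigDim Γ ∧ rigDimFin Λ ≤ rigDimFin Γ ∧ repDim Γ ≤ repDim Λ := by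
  refine ⟨iSup₂_le fun V hV => ?_, iSup₂_le fun V hV => iSup_le fun hfin => ?_,
    le_iInf₂ fun V hV => ?_⟩
  all_goals obtain ⟨W, hW, hdom, hgl⟩ := h V hV
  · exact le_iSup₂_of_le W hW hdom
  · exact le_iSup₂_of_le W hW (le_iSup_of_le (hgl.trans_lt hfin) hdom)
  · exact iInf₂_le_of_le W hW hgl

end Descent

/-! ### Bimodule maps as natural transformations of tensor functors -/

section TensorFunctors

namespace BalancedTensor

section

universe v₁ v₂ v₃ v₄ v₅ v₆ v₇

variable (Γ : Type v₁) [Ring Γ] {M : Type v₂} [AddCommGroup M] [Module Γᵐᵒᵖ M]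
  {N : Type v₃} [AddCommGroup N] [Module Γ N]

/-- The additive map out of a balanced tensor product induced by a balanced biadditive map. -/
def lift {P : Type v₄} [AddCommGroup P] (f : M →+ N →+ P)
    (hf : ∀ (m : M) (c : Γ) (n : N), f (MulOpposite.op c • m) n = f m (c • n)) :
    BalancedTensor Γ M N →+ P :=
  QuotientAddGroup.lift (relations Γ M N) (TensorProduct.liftAddHom f fun r m n => by simp)
    ((AddSubgroup.closure_le _).2 (by
      rintro _ ⟨m, c, n, rfl⟩
      simp [hf]))

variable {Γ} in
theorem induction_on {p : BalancedTensor Γ M N → Prop} (x : BalancedTensor Γ M N) (h0 : p 0)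
    (ht : ∀ m n, p (tmul Γ m n)) (ha : ∀ x y, p x → p y → p (x + y)) : p x := by
  obtain ⟨t, rfl⟩ := QuotientAddGroup.mk'_surjective (relations Γ M N) x
  induction t using TensorProduct.induction_on with
  | zero => simpa using! h0
  | tmul m n => exact ht m n
  | add a b iha ihb => rw [map_add]; exact ha _ _ iha ihb

theorem lTensor_add {Λ : Type v₆} [Ring Λ] [Module Λ M] [SMulCommClass Λ Γᵐᵒᵖ M]
    {N' : Type v₅} [AddCommGroup N'] [Module Γ N'] (f g : N →ₗ[Γ] N') :
    lTensor (Λ := Λ) Γ M (f + g) = lTensor Γ M f + lTensor Γ M g := by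
  refine LinearMap.ext fun x => ?_
  rw [LinearMap.add_apply]
  induction x using induction_on with
  | h0 => simp only [map_zero, add_zero]
  | ht m n => exact tmul_add Γ m (f n) (g n)
  | ha x y hx hy => rw [map_add, map_add, map_add, hx, hy, add_add_add_comm]

theorem finite {Λ : Type v₆} [Ring Λ] [Module Λ M] [SMulCommClass Λ Γᵐᵒᵖ M]
    (hM : Module.Finite Λ M) (hN : Module.Finite Γ N) :
    Module.Finite Λ (BalancedTensor Γ M N) := by
  classical
  obtain ⟨s, hs⟩ := hM
  obtain ⟨t, ht⟩ := hN
  let T : Finset (BalancedTensor Γ M N) := (s ×ˢ t).image fun x => tmul Γ x.1 x.2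
  refine ⟨⟨T, eq_top_iff.2 fun x _ => ?_⟩⟩
  have h1 (m : M) (n : N) (hn : n ∈ t) : tmul Γ m n ∈ Submodule.span Λ (T : Set _) := by
    have hm : m ∈ Submodule.span Λ (s : Set M) := hs ▸ Submodule.mem_top
    induction hm using Submodule.span_induction with
    | mem m hm =>
      exact Submodule.subset_span (Finset.mem_coe.2 (Finset.mem_image.2
        ⟨(m, n), Finset.mem_product.2 ⟨hm, hn⟩, rfl⟩))
    | zero => rw [zero_tmul]; exact Submodule.zero_mem _
    | add a b _ _ ha hb => rw [add_tmul]; exact Submodule.add_mem _ ha hb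
    | smul c a _ ha => rw [← left_smul_tmul]; exact Submodule.smul_mem _ c ha
  -- Here `m` stays arbitrary because a scalar from `Γ` acting on `n` is moved onto `m`.
  have h2 (n : N) : ∀ m : M, tmul Γ m n ∈ Submodule.span Λ (T : Set _) := by
    have hn : n ∈ Submodule.span Γ (t : Set N) := ht ▸ Submodule.mem_top
    induction hn using Submodule.span_induction with
    | mem n hn => exact fun m => h1 m n hn
    | zero => intro m; rw [tmul_zero]; exact Submodule.zero_mem _
    | add a b _ _ ha hb => intro m; rw [tmul_add]; exact Submodule.add_mem _ (ha m) (hb m)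
    | smul c a _ ha => intro m; rw [← smul_tmul]; exact ha _
  induction x using induction_on with
  | h0 => exact Submodule.zero_mem _
  | ht m n => exact h2 n m
  | ha x y hx hy => exact Submodule.add_mem _ (hx trivial) (hy trivial)

end

end BalancedTensor

open BalancedTensor

variable {Λ Γ : Type u} [Ring Λ] [Ring Γ] (M N : Type u)
    [AddCommGroup M] [Module Λ M] [Module Γᵐᵒᵖ M] [SMulCommClass Λ Γᵐᵒᵖ M]
    [AddCommGroup N] [Module Γ N] [Module Λᵐᵒᵖ N] [SMulCommClass Γ Λᵐᵒᵖ N]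

instance bimoduleTensorFunctor_additive : (bimoduleTensorFunctor Λ Γ M).Additive where
  map_add {_ _ f g} :=
    ModuleCat.hom_ext (lTensor_add Γ f.hom g.hom)

/-- The insertion `n ↦ m ⊗ (n ⊗ v)` as a map in `m ⊗ n`. -/
noncomputable def tensorInsert (V : ModuleCat.{u} Λ) (v : V) :
    BalancedTensor Γ M N →ₗ[Λ] BalancedTensor Γ M (BalancedTensor Λ N V) :=
  lTensor Γ M
    { toFun := fun n => tmul Λ n v
      map_add' := fun a b => add_tmul Λ a b v
      map_smul' := fun _ _ => rfl }

theorem tensorInsert_tmul (V : ModuleCat.{u} Λ) (v : V) (m : M) (n : N) :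
    tensorInsert M N V v (tmul Γ m n) = tmul Γ m (tmul Λ n v) := rfl

theorem tensorInsert_add (V : ModuleCat.{u} Λ) (v w : V) (x : BalancedTensor Γ M N) :
    tensorInsert M N V (v + w) x = tensorInsert M N V v x + tensorInsert M N V w x := by
  induction x using induction_on with
  | h0 => simp
  | ht m n => exact (congrArg (tmul Γ m) (tmul_add Λ n v w)).trans (tmul_add Γ m _ _)
  | ha x y hx hy => rw [map_add, map_add, map_add, hx, hy, add_add_add_comm]

/-- A scalar moves from `v` across the inner tensor product to the right of `n`. For central `x` it
can then be pulled out on the left, which makes `centralInsert` linear over `Λ`. -/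
theorem tensorInsert_smul (V : ModuleCat.{u} Λ) (c : Λ) (v : V) (x : BalancedTensor Γ M N) :
    tensorInsert M N V (c • v) x = tensorInsert M N V v (MulOpposite.op c • x) := by
  induction x using induction_on with
  | h0 => rw [smul_zero, map_zero, map_zero]
  | ht m n => exact congrArg (tmul Γ m) (smul_tmul Λ n c v).symm
  | ha x y hx hy => rw [smul_add, map_add, map_add, hx, hy]

/-- A central element of `M ⊗_Γ N` induces a natural map `V → M ⊗_Γ (N ⊗_Λ V)`. -/
noncomputable def centralInsert (t : BalancedTensor Γ M N)
    (ht : ∀ c : Λ, c • t = MulOpposite.op c • t) :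
    𝟭 _ ⟶ bimoduleTensorFunctor Γ Λ N ⋙ bimoduleTensorFunctor Λ Γ M where
  app V := ModuleCat.ofHom (Y := BalancedTensor Γ M (BalancedTensor Λ N V))
    { toFun := fun v => tensorInsert M N V v t
      map_add' := fun v w => tensorInsert_add M N V v w t
      map_smul' := fun c v => by
        rw [tensorInsert_smul, ← ht, map_smul]; rfl }
  naturality V W f := by
    refine ModuleCat.hom_ext (LinearMap.ext fun v => ?_)
    exact DFunLike.congr_fun (hom_ext Γ (f := (tensorInsert M N W (f v)).toAddMonoidHom)
      (g := (map Γ LinearMap.id (lTensor (Λ := Γ) Λ N f.hom)).comp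
        (tensorInsert M N V v).toAddMonoidHom) fun m n => rfl) t

variable {M N}

/-- The map `N ⊗_Λ V → V`, `n ⊗ v ↦ f (m ⊗ n) v`, induced by a bimodule map
`f : M ⊗_Γ N → Λ` and an element `m`. -/
noncomputable def tensorContractAux (f : BalancedTensor Γ M N →ₗ[Λ] Λ)
    (hf : ∀ (c : Λ) x, f (MulOpposite.op c • x) = f x * c) (V : ModuleCat.{u} Λ) (m : M) :
    BalancedTensor Λ N V →+ V :=
  lift Λ (AddMonoidHom.mk' (fun n =>
      AddMonoidHom.mk' (fun v => f (tmul Γ m n) • v) fun v w => smul_add _ v w)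
        fun n n' => AddMonoidHom.ext fun v =>
          (congrArg (f · • v) (tmul_add Γ m n n')).trans
            ((congrArg (· • v) (map_add f _ _)).trans (add_smul _ _ v)))
    fun n c v => (congrArg (· • v) (hf c (tmul Γ m n))).trans (mul_smul _ c v)

theorem tensorContractAux_tmul (f : BalancedTensor Γ M N →ₗ[Λ] Λ)
    (hf : ∀ (c : Λ) x, f (MulOpposite.op c • x) = f x * c) (V : ModuleCat.{u} Λ) (m : M)
    (n : N) (v : V) : tensorContractAux f hf V m (tmul Λ n v) = f (tmul Γ m n) • v := rfl

/-- The map `M ⊗_Γ (N ⊗_Λ V) → V` induced by a bimodule map `M ⊗_Γ N → Λ`. -/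
noncomputable def tensorContract (f : BalancedTensor Γ M N →ₗ[Λ] Λ)
    (hf : ∀ (c : Λ) x, f (MulOpposite.op c • x) = f x * c) (V : ModuleCat.{u} Λ) :
    BalancedTensor Γ M (BalancedTensor Λ N V) →+ V :=
  lift Γ (AddMonoidHom.mk' (tensorContractAux f hf V) fun m m' => hom_ext Λ fun n v => by
      rw [AddMonoidHom.add_apply]
      simp only [tensorContractAux_tmul, add_tmul, map_add, add_smul])
    fun m c x => by
      simp only [AddMonoidHom.mk'_apply]
      induction x using induction_on with
      | h0 => rw [smul_zero, map_zero, map_zero]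
      | ht n v =>
        rw [left_smul_tmul, tensorContractAux_tmul, tensorContractAux_tmul, smul_tmul]
      | ha x y hx hy => rw [smul_add, map_add, map_add, hx, hy]

theorem tensorContract_tmul (f : BalancedTensor Γ M N →ₗ[Λ] Λ)
    (hf : ∀ (c : Λ) x, f (MulOpposite.op c • x) = f x * c) (V : ModuleCat.{u} Λ) (m : M)
    (n : N) (v : V) : tensorContract f hf V (tmul Γ m (tmul Λ n v)) = f (tmul Γ m n) • v := rfl

theorem tensorContract_tensorInsert (f : BalancedTensor Γ M N →ₗ[Λ] Λ)
    (hf : ∀ (c : Λ) x, f (MulOpposite.op c • x) = f x * c) (V : ModuleCat.{u} Λ) (v : V)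
    (x : BalancedTensor Γ M N) : tensorContract f hf V (tensorInsert M N V v x) = f x • v := by
  induction x using induction_on with
  | h0 => simp
  | ht m n => rfl
  | ha x y hx hy => rw [map_add, map_add, map_add, hx, hy, add_smul]

omit [Module Λ M] [SMulCommClass Λ Γᵐᵒᵖ M] in
theorem iterated_induction_on {V : ModuleCat.{u} Λ}
    {p : BalancedTensor Γ M (BalancedTensor Λ N V) → Prop}
    (x : BalancedTensor Γ M (BalancedTensor Λ N V)) (h0 : p 0)
    (ht : ∀ m n v, p (tmul Γ m (tmul Λ n v))) (ha : ∀ x y, p x → p y → p (x + y)) : p x := by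
  induction x using induction_on with
  | h0 => exact h0
  | ht m y =>
    induction y using induction_on with
    | h0 => rwa [tmul_zero]
    | ht n v => exact ht m n v
    | ha x y hx hy => rw [tmul_add]; exact ha _ _ hx hy
  | ha x y hx hy => exact ha _ _ hx hy

theorem tensorContract_lTensor (f : BalancedTensor Γ M N →ₗ[Λ] Λ)
    (hf : ∀ (c : Λ) x, f (MulOpposite.op c • x) = f x * c) {V W : ModuleCat.{u} Λ}
    (g : V →ₗ[Λ] W) (x : BalancedTensor Γ M (BalancedTensor Λ N V)) :
    tensorContract f hf W (lTensor (Λ := Λ) Γ M (lTensor (Λ := Γ) Λ N g) x) =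
      g (tensorContract f hf V x) := by
  induction x using iterated_induction_on with
  | h0 => simp only [map_zero]
  | ht m n v => exact (g.map_smul (f (tmul Γ m n)) v).symm
  | ha x y hx hy => rw [map_add, map_add, map_add, map_add, hx, hy]

/-- This is the dual basis identity for `M ⊗_Γ N` tensored with `V`: on `m ⊗ n ⊗ v` the scalar `f i
(m ⊗ n)` passes from `v` to `t i` by centrality. -/
theorem sum_tensorInsert_tensorContract {k : ℕ} (f : Fin k → BalancedTensor Γ M N →ₗ[Λ] Λ)
    (hf : ∀ i (c : Λ) x, f i (MulOpposite.op c • x) = f i x * c)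
    (t : Fin k → BalancedTensor Γ M N) (ht : ∀ i (c : Λ), c • t i = MulOpposite.op c • t i)
    (hsum : ∀ x, ∑ i, f i x • t i = x) {V : ModuleCat.{u} Λ}
    (x : BalancedTensor Γ M (BalancedTensor Λ N V)) :
    ∑ i, tensorInsert M N V (tensorContract (f i) (hf i) V x) (t i) = x := by
  induction x using iterated_induction_on with
  | h0 =>
    refine Finset.sum_eq_zero fun i _ => ?_
    rw [map_zero, ← zero_smul Λ (0 : V), tensorInsert_smul, ← ht, zero_smul, map_zero]
  | ht m n v =>
    rw [← tensorInsert_tmul]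
    conv_rhs => rw [← hsum (tmul Γ m n), map_sum]
    refine Finset.sum_congr rfl fun i _ => ?_
    rw [tensorInsert_tmul, tensorContract_tmul, tensorInsert_smul, ← ht]
  | ha x y hx hy =>
    simp only [map_add, tensorInsert_add, Finset.sum_add_distrib, hx, hy]

/-- A bimodule map `M ⊗_Γ N → Λ` induces a natural map `M ⊗_Γ (N ⊗_Λ V) → V`. -/
noncomputable def contract (f : BalancedTensor Γ M N →ₗ[Λ] Λ)
    (hf : ∀ (c : Λ) x, f (MulOpposite.op c • x) = f x * c) :
    bimoduleTensorFunctor Γ Λ N ⋙ bimoduleTensorFunctor Λ Γ M ⟶ 𝟭 _ where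
  app V := ModuleCat.ofHom (X := BalancedTensor Γ M (BalancedTensor Λ N V))
    { tensorContract f hf V with
      map_smul' := fun c x => by
        change tensorContract f hf V (c • x) = c • tensorContract f hf V x
        induction x using iterated_induction_on with
        | h0 => rw [smul_zero, map_zero, smul_zero]
        | ht m n v =>
          rw [left_smul_tmul, tensorContract_tmul, tensorContract_tmul, ← left_smul_tmul,
            map_smul, smul_assoc]
        | ha x y hx hy => rw [smul_add, map_add, map_add, hx, hy, smul_add] }
  naturality V W g := ModuleCat.hom_ext (LinearMap.ext fun x =>
    tensorContract_lTensor f hf g.hom x)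

/-- The projection to `Λ` is the contraction, and the element corresponding to `(1, 0)` is central
because `1` commutes with every scalar. -/
theorem exists_retract_of_isBimoduleSummand
    (h : IsBimoduleSummand Λ Λ Λ (BalancedTensor Γ M N)) :
    ∃ (s : 𝟭 _ ⟶ bimoduleTensorFunctor Γ Λ N ⋙ bimoduleTensorFunctor Λ Γ M)
      (r : bimoduleTensorFunctor Γ Λ N ⋙ bimoduleTensorFunctor Λ Γ M ⟶ 𝟭 _), s ≫ r = 𝟙 _ := by
  obtain ⟨X, _, _, _, _, e, he⟩ := h
  have he' (c : Λᵐᵒᵖ) (x : Λ × X) : e.symm (c • x) = c • e.symm x := by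
    rw [LinearEquiv.symm_apply_eq, he, LinearEquiv.apply_symm_apply]
  let f : BalancedTensor Γ M N →ₗ[Λ] Λ := LinearMap.fst Λ Λ X ∘ₗ e.toLinearMap
  have hf (c : Λ) (x : BalancedTensor Γ M N) : f (MulOpposite.op c • x) = f x * c :=
    congrArg Prod.fst (he _ x)
  let t : BalancedTensor Γ M N := e.symm (1, 0)
  have ht (c : Λ) : c • t = MulOpposite.op c • t := by
    rw [← map_smul, ← he']
    exact congrArg e.symm (Prod.ext (by simp) (by simp))
  have hft : f t = 1 := congrArg Prod.fst (e.apply_symm_apply _)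
  refine ⟨centralInsert M N t ht, contract f hf, ?_⟩
  ext V v
  refine (tensorContract_tensorInsert f hf V v t).trans ?_
  rw [hft]
  exact one_smul _ _

/-- A bimodule summand of `Λ^k` has a dual basis of bimodule maps `f i` (the coordinates) and
central elements `t i` (the components of the standard basis vectors). -/
theorem exists_sum_eq_id_of_isCentrallyProjective
    (h : IsCentrallyProjective Λ (BalancedTensor Γ M N)) (V : ModuleCat.{u} Λ) :
    ∃ (k : ℕ)
      (p : Fin k → ((bimoduleTensorFunctor Λ Γ M).obj ((bimoduleTensorFunctor Γ Λ N).obj V) ⟶ V))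
      (q : Fin k → (V ⟶ (bimoduleTensorFunctor Λ Γ M).obj ((bimoduleTensorFunctor Γ Λ N).obj V))),
      ∑ i, p i ≫ q i = 𝟙 _ := by
  obtain ⟨k, X, _, _, _, _, e, he⟩ := h
  have he' (c : Λᵐᵒᵖ) (x : BalancedTensor Γ M N × X) : e.symm (c • x) = c • e.symm x := by
    rw [LinearEquiv.symm_apply_eq, he, LinearEquiv.apply_symm_apply]
  let f (i : Fin k) : BalancedTensor Γ M N →ₗ[Λ] Λ :=
    LinearMap.proj i ∘ₗ e.symm.toLinearMap ∘ₗ LinearMap.inl Λ _ X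
  have hf (i : Fin k) (c : Λ) (x : BalancedTensor Γ M N) :
      f i (MulOpposite.op c • x) = f i x * c := by
    have := he' (MulOpposite.op c) (x, 0)
    rw [Prod.smul_mk, smul_zero] at this
    exact congrFun this i
  let t (i : Fin k) : BalancedTensor Γ M N := (e (Pi.single i 1)).1
  have ht (i : Fin k) (c : Λ) : c • t i = MulOpposite.op c • t i := by
    have h1 : c • (Pi.single i 1 : Fin k → Λ) = MulOpposite.op c • Pi.single i 1 := by
      rw [← Pi.single_smul, ← Pi.single_smul]; simp
    have h2 := (map_smul e c (Pi.single i 1)).symm.trans ((congrArg e h1).trans (he _ _))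
    exact congrArg Prod.fst h2
  have hsum (x : BalancedTensor Γ M N) : ∑ i, f i x • t i = x := by
    have h1 : e.symm (x, 0) = ∑ i, f i x • (Pi.single i 1 : Fin k → Λ) := by
      conv_lhs => rw [← Finset.univ_sum_single (e.symm (x, 0))]
      exact Finset.sum_congr rfl fun i _ => by
        rw [← Pi.single_smul, smul_eq_mul, mul_one]; rfl
    have h2 := congrArg (fun z => (e z).1) h1
    simp only [LinearEquiv.apply_symm_apply, map_sum, map_smul, Prod.fst_sum, Prod.smul_fst] at h2
    exact h2.symm
  refine ⟨k, fun i => (contract (f i) (hf i)).app V,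
    fun i => (centralInsert M N (t i) (ht i)).app V, ModuleCat.hom_ext (LinearMap.ext fun x => ?_)⟩
  rw [ModuleCat.hom_sum, LinearMap.sum_apply]
  exact sum_tensorInsert_tensorContract f hf t ht hsum x

end TensorFunctors

/-! ### Conclusion by symmetry -/

theorem SymmetricallySeparablyEquivalentBy.exists_domDim_le_glDim_le
    {Λ Γ : Type u} [Ring Λ] [Ring Γ] {M N : Type u}
    [AddCommGroup M] [Module Λ M] [Module Γᵐᵒᵖ M] [SMulCommClass Λ Γᵐᵒᵖ M]
    [AddCommGroup N] [Module Γ N] [Module Λᵐᵒᵖ N] [SMulCommClass Γ Λᵐᵒᵖ N]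
    (hequiv : SymmetricallySeparablyEquivalentBy Λ Γ M N)
    (hMN : IsCentrallyProjective Λ (BalancedTensor Γ M N))
    {V : ModuleCat.{u} Λ} (hV : IsAuslanderGenerator Λ V) :
    ∃ W : ModuleCat.{u} Γ, IsAuslanderGenerator Γ W ∧
      domDim (EndAlg Λ V) ≤ domDim (EndAlg Γ W) ∧ glDim (EndAlg Γ W) ≤ glDim (EndAlg Λ V) := by
  -- Here `F = N ⊗_Λ -` and `G = M ⊗_Γ -`. The retract comes from the `Γ`-bimodule `N ⊗_Λ M`, the
  -- decomposition of `GFV` from the `Λ`-bimodule `M ⊗_Γ N`.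
  obtain ⟨adj⟩ := hequiv.adj_NM
  obtain ⟨adj'⟩ := hequiv.adj_MN
  exact hV.exists_domDim_le_glDim_le adj adj'
    (fun X hX => BalancedTensor.finite Λ hequiv.finite_left_N hX)
    (fun X hX => BalancedTensor.finite Γ hequiv.finite_left_M hX)
    (exists_retract_of_isBimoduleSummand hequiv.summand_right)
    (exists_sum_eq_id_of_isCentrallyProjective hMN)

theorem SymmetricallySeparablyEquivalentBy.symm {Λ Γ : Type u} [Ring Λ] [Ring Γ] {M N : Type u}
    [AddCommGroup M] [Module Λ M] [Module Γᵐᵒᵖ M] [SMulCommClass Λ Γᵐᵒᵖ M]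
    [AddCommGroup N] [Module Γ N] [Module Λᵐᵒᵖ N] [SMulCommClass Γ Λᵐᵒᵖ N]
    (h : SymmetricallySeparablyEquivalentBy Λ Γ M N) :
    SymmetricallySeparablyEquivalentBy Γ Λ N M where
  finite_left_M := h.finite_left_N
  projective_left_M := h.projective_left_N
  finite_right_M := h.finite_right_N
  projective_right_M := h.projective_right_N
  finite_left_N := h.finite_left_M
  projective_left_N := h.projective_left_M
  finite_right_N := h.finite_right_M
  projective_right_N := h.projective_right_M
  summand_left := h.summand_right
  summand_right := h.summand_left
  adj_MN := h.adj_NM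
  adj_NM := h.adj_MN

theorem corollary3p12 {R : Type w} [CommRing R] [IsArtinianRing R]
    {Λ Γ : Type u} [Ring Λ] [Ring Γ] [Algebra R Λ] [Algebra R Γ]
    [Module.Finite R Λ] [Module.Finite R Γ]
    (M N : Type u)
    [AddCommGroup M] [Module Λ M] [Module Γᵐᵒᵖ M] [SMulCommClass Λ Γᵐᵒᵖ M]
    [AddCommGroup N] [Module Γ N] [Module Λᵐᵒᵖ N] [SMulCommClass Γ Λᵐᵒᵖ N]
    (hequiv : SymmetricallySeparablyEquivalentBy Λ Γ M N)
    (hMN : IsCentrallyProjective Λ (BalancedTensor Γ M N))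
    (hNM : IsCentrallyProjective Γ (BalancedTensor Λ N M)) :
    (rigDim Λ = rigDim Γ ∧ rigDimFin Λ = rigDimFin Γ) ∧ repDim Λ = repDim Γ := by
  obtain ⟨h1, h2, h3⟩ := rigDim_le_of_forall_exists fun V hV =>
    hequiv.exists_domDim_le_glDim_le hMN (V := V) hV
  obtain ⟨h4, h5, h6⟩ := rigDim_le_of_forall_exists fun V hV =>
    hequiv.symm.exists_domDim_le_glDim_le hNM (V := V) hV
  exact ⟨⟨h1.antisymm h4, h2.antisymm h5⟩, h6.antisymm h3⟩
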